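/- **Setting.** Let $k,\sigma,\delta,L,\hat L>0$, $N\ge 1$, $a_j=a_1+(j-1)L$, $b_j=a_j+L+2\delta$ and $\Omega_j=(a_j,b_j)\times(0,\hat L)$ for $j=1,\dots,N$. Consider the parallel Schwarz method for the two-dimensional transverse electric Maxwell equations $-k^2\mathbf E+\nabla\times(\nabla\times\mathbf E)+ik\sigma\mathbf E=0$ on $\bigcup_j\Omega_j$, with the perfectly conducting condition $E_x=0$ at $y\in\{0,\hat L\}$. It uses the impedance operators $\mathcal B_l\mathbf E=(-\partial_x+ik)E_y+\partial_yE_x$ and $\mathcal B_r\mathbf E=(\partial_x+ik)E_y-\partial_yE_x$ at the ends and for the transmission between subdomains. Its errors $\mathbf e_j^n$ (subdomain $j$, iteration $n$; $\mathbf e_j^0$ arbitrary), taken to be $C^2$ up to the boundary, satisfy for $n\ge1$ the Maxwell equations in $\Omega_j$, the perfectly conducting condition, $\mathcal B_l\mathbf e_j^n=\mathcal B_l\mathbf e_{j-1}^{n-1}$ at $x=a_j$ for $j\ge2$, $\mathcal B_r\mathbf e_j^n=\mathcal B_r\mathbf e_{j+1}^{n-1}$ at $x=b_j$ for $j\le N-1$,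 $\mathcal B_l\mathbf e_1^n=0$ at $x=a_1$, and $\mathcal B_r\mathbf e_N^n=0$ at $x=b_N$. For a Fourier number $\tilde k\in\{m\pi/\hat L: m=1,2,\dots\}$ put $\zeta=\sqrt{ik\sigma+\tilde k^2-k^2}$ (principal branch), $\alpha=ik+\sigma$, $D=(\zeta+\alpha)^2e^{\zeta(2\delta+L)}-(\zeta-\alpha)^2e^{-\zeta(2\delta+L)}$, $$a=\frac{(\zeta+\alpha)^2e^{2\zeta\delta}-(\zeta-\alpha)^2e^{-2\zeta\delta}}{D},\qquad b=-\frac{(\zeta^2-\alpha^2)(e^{\zeta L}-e^{-\zeta L})}{D}.$$ Let $\mathcal T_N(\tilde k)=\mathcal T_{1d}^{\mathrm M}(\tilde k)\in\mathbb C^{2(N-1)\times2(N-1)}$ be the block tridiagonal Toeplitz matrix with diagonal blocks $\begin{bmatrix}0&b\\b&0\end{bmatrix}$, super-diagonal blocks $\begin{bmatrix}a&0\\0&0\end{bmatrix}$ and sub-diagonal blocks $\begin{bmatrix}0&0\\0&a\end{bmatrix}$. Let $\rho$ denote the spectral radius (zero for the empty matrix) and define $$R_{1d}^{\mathrm M}(\tilde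 k)=\lim_{N\to\infty}\rho(\mathcal T_N(\tilde k)),\qquad R_{2d}^{\mathrm M}=\sup_{\tilde k}R_{1d}^{\mathrm M}(\tilde k).$$ Let $\mathcal R^n(\tilde k)\in\mathbb C^{2(N-1)}$ be the vector of interface data of the mode $\tilde k$: its $j$-th block ($1\le j\le N-1$) is $$\Big(\int_0^{\hat L}(\mathcal B_r\mathbf e^n_{j+1})(b_j,y)\cos(\tilde ky)\,dy,\;-\int_0^{\hat L}(\mathcal B_l\mathbf e^n_{j})(a_{j+1},y)\cos(\tilde ky)\,dy\Big).$$ **Statement.** There is a function $\bar R=\bar R(\sigma_0,\delta_0,L_0)\in[0,\infty)$ with the following properties. 1. Let $\sigma_0,\delta_0,L_0,\hat L>0$ and, for each $k>0$, let $\sigma=\sigma_0k$, $\delta=\delta_0/k$, $L=L_0/k$. Then: - for all $k>0$ and all $\tilde k$, the limit defining $R_{1d}^{\mathrm M}(\tilde k)$ exists; - $R_{2d}^{\mathrm M}\le\bar R(\sigma_0,\delta_0,L_0)$ for all $k>0$; - this bound is tight in the limit: $R_{2d}^{\mathrm M}\to\bar R(\sigma_0,\delta_0,L_0)$ as $k\to\infty$;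 - for all $k>0$, all $\tilde k$ and every number $N$ of subdomains, $\rho(\mathcal T_N(\tilde k))\le\bar R(\sigma_0,\delta_0,L_0)$, and the errors of the Schwarz method satisfy $\mathcal R^{n+1}(\tilde k)=\mathcal T_N(\tilde k)\,\mathcal R^{n}(\tilde k)$ and $\|\mathcal R^{n}(\tilde k)\|_2\le\bar R(\sigma_0,\delta_0,L_0)^n\,\|\mathcal R^0(\tilde k)\|_2$ for all $n\ge0$. 2. $\bar R(\sigma_0,\delta_0,L_0)<1$ if between them $\sigma_0,\delta_0,L_0$ are sufficiently large. In particular, this holds whenever $\sigma_0\ge1$ (for all $\delta_0,L_0>0$). Also, for each $\sigma_0>0$ there is $M$ such that it holds for all $\delta_0,L_0>0$ with $\max\{\delta_0,L_0\}\ge M$. Thus, in the situation of 2, the method converges at a rate independent of the wave number and of the number of subdomains. -/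

import Mathlib

open Filter Topology
open scoped NNReal ENNReal

noncomputable section

/-! ### The iteration matrices -/

/-- The `2m × 2m` block tridiagonal Toeplitz matrix with `2 × 2` diagonal blocks `[[0, b], [b, 0]]`,
super-diagonal blocks `[[a, 0], [0, 0]]` and sub-diagonal blocks `[[0, 0], [0, a]]`. The index
`(j, s)` is row `s` of block `j`. -/
def schwarzToeplitz (a b : ℂ) (m : ℕ) : Matrix (Fin m × Fin 2) (Fin m × Fin 2) ℂ :=
  fun p q =>
    if p.1 = q.1 then (!![0, b; b, 0] : Matrix (Fin 2) (Fin 2) ℂ) p.2 q.2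
    else if (p.1 : ℕ) + 1 = q.1 then (!![a, 0; 0, 0] : Matrix (Fin 2) (Fin 2) ℂ) p.2 q.2
    else if (q.1 : ℕ) + 1 = p.1 then (!![0, 0; 0, a] : Matrix (Fin 2) (Fin 2) ℂ) p.2 q.2
    else 0

/-- The common denominator of the coefficients `a` and `b`. -/
def schwarzD (ζ α : ℂ) (δ L : ℝ) : ℂ :=
  (ζ + α) ^ 2 * Complex.exp (ζ * (2 * δ + L)) - (ζ - α) ^ 2 * Complex.exp (-ζ * (2 * δ + L))

/-- The coefficient `a` of the one-dimensional Schwarz iteration matrix for the equation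
`-u'' + ζ² u = 0` and transmission conditions with impedance parameter `α`. -/
def schwarzA (ζ α : ℂ) (δ L : ℝ) : ℂ :=
  ((ζ + α) ^ 2 * Complex.exp (2 * ζ * δ) - (ζ - α) ^ 2 * Complex.exp (-(2 * ζ * δ)))
    / schwarzD ζ α δ L

/-- The coefficient `b` of the same matrix. -/
def schwarzB (ζ α : ℂ) (δ L : ℝ) : ℂ :=
  -((ζ ^ 2 - α ^ 2) * (Complex.exp (ζ * L) - Complex.exp (-ζ * L))) / schwarzD ζ α δ L

/-- `ζ(κ) = √(i k σ + κ² - k²)`, principal branch; `κ` is the Fourier number. -/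
def maxwellZeta (k σ κ : ℝ) : ℂ :=
  Complex.sqrt (Complex.I * k * σ + (κ : ℂ) ^ 2 - (k : ℂ) ^ 2)

/-- The iteration matrix, for `N` subdomains and Fourier number `κ`, of the Schwarz method for the
two-dimensional transverse electric Maxwell problem: the one-dimensional matrix with
`α = i k + σ` and `ζ = ζ(κ)`. It acts on the `2 (N - 1)` interface data. -/
def maxwellT (k σ δ L κ : ℝ) (N : ℕ) : Matrix (Fin (N - 1) × Fin 2) (Fin (N - 1) × Fin 2) ℂ :=
  schwarzToeplitz (schwarzA (maxwellZeta k σ κ) (Complex.I * k + σ) δ L)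
    (schwarzB (maxwellZeta k σ κ) (Complex.I * k + σ) δ L) (N - 1)

/-- The convergence factor of the Fourier mode `κ`: the limit, as the number of subdomains tends to
infinity, of the spectral radius of the iteration matrix. -/
def maxwellR1d (k σ δ L κ : ℝ) : ℝ≥0∞ :=
  limUnder atTop fun N : ℕ => spectralRadius ℂ (maxwellT k σ δ L κ N)

/-- The Fourier numbers of a strip of height `Lhat`: `m π / Lhat`, with `m ≥ 1`. -/
def fourierNumber (Lhat : ℝ) (m : ℕ) : ℝ := m * Real.pi / Lhat

/-- The convergence factor of the two-dimensional Maxwell problem: the supremum over all Fourier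
numbers of the one-dimensional factors. -/
def maxwellR2d (Lhat k σ δ L : ℝ) : ℝ≥0∞ :=
  ⨆ m : {m : ℕ // 1 ≤ m}, maxwellR1d k σ δ L (fourierNumber Lhat m)

/-! ### The Schwarz method for the transverse electric Maxwell equations -/

/-- Partial derivative in the first variable. -/
def partialX (F : ℝ → ℝ → ℂ) (x y : ℝ) : ℂ := deriv (fun s => F s y) x

/-- Partial derivative in the second variable. -/
def partialY (F : ℝ → ℝ → ℂ) (x y : ℝ) : ℂ := deriv (fun t => F x t) y

/-- Left impedance operator `(-∂ₓ + i k) E_y + ∂_y E_x`. -/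
def impedanceL (k : ℝ) (Ex Ey : ℝ → ℝ → ℂ) (x y : ℝ) : ℂ :=
  -partialX Ey x y + Complex.I * k * Ey x y + partialY Ex x y

/-- Right impedance operator `(∂ₓ + i k) E_y - ∂_y E_x`. -/
def impedanceR (k : ℝ) (Ex Ey : ℝ → ℝ → ℂ) (x y : ℝ) : ℂ :=
  partialX Ey x y + Complex.I * k * Ey x y - partialY Ex x y

/-- Left end of subdomain `j`; subdomains are numbered from `0`. -/
def leftEnd (a₁ L : ℝ) (j : ℕ) : ℝ := a₁ + j * L

/-- Right end of subdomain `j`: every subdomain has width `L + 2δ`, and neighbours overlap in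
width `2δ`. -/
def rightEnd (a₁ δ L : ℝ) (j : ℕ) : ℝ := leftEnd a₁ L j + L + 2 * δ

/-- The errors of the parallel Schwarz method with impedance transmission conditions, on `N`
subdomains `(a_j, b_j) × (0, Lhat)`. The error in subdomain `j` after `n` iterations has the
components `Ex n j`, `Ey n j`, which are restrictions of `C²` functions on the plane. The initial
error (`n = 0`) is arbitrary. -/
structure IsMaxwellSchwarzError (k σ δ L Lhat a₁ : ℝ) (N : ℕ)
    (Ex Ey : ℕ → ℕ → ℝ → ℝ → ℂ) : Prop where
  smooth_x : ∀ n j, j < N → ContDiff ℝ 2 fun p : ℝ × ℝ => Ex n j p.1 p.2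
  smooth_y : ∀ n j, j < N → ContDiff ℝ 2 fun p : ℝ × ℝ => Ey n j p.1 p.2
  /-- First component of the equation `-k² E + curl curl E + i k σ E = 0`. -/
  maxwell_x : ∀ n j, j < N → ∀ x ∈ Set.Ioo (leftEnd a₁ L j) (rightEnd a₁ δ L j),
    ∀ y ∈ Set.Ioo 0 Lhat,
      -(k : ℂ) ^ 2 * Ex (n + 1) j x y - partialY (partialY (Ex (n + 1) j)) x y
        + partialX (partialY (Ey (n + 1) j)) x y + Complex.I * k * σ * Ex (n + 1) j x y = 0
  /-- Second component of the same equation. -/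
  maxwell_y : ∀ n j, j < N → ∀ x ∈ Set.Ioo (leftEnd a₁ L j) (rightEnd a₁ δ L j),
    ∀ y ∈ Set.Ioo 0 Lhat,
      -(k : ℂ) ^ 2 * Ey (n + 1) j x y - partialX (partialX (Ey (n + 1) j)) x y
        + partialX (partialY (Ex (n + 1) j)) x y + Complex.I * k * σ * Ey (n + 1) j x y = 0
  /-- Perfect electric conductor at the bottom and at the top. -/
  pec : ∀ n j, j < N → ∀ x ∈ Set.Ioo (leftEnd a₁ L j) (rightEnd a₁ δ L j),
    Ex (n + 1) j x 0 = 0 ∧ Ex (n + 1) j x Lhat = 0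
  transmission_left : ∀ n j, j + 1 < N → ∀ y ∈ Set.Ioo 0 Lhat,
    impedanceL k (Ex (n + 1) (j + 1)) (Ey (n + 1) (j + 1)) (leftEnd a₁ L (j + 1)) y
      = impedanceL k (Ex n j) (Ey n j) (leftEnd a₁ L (j + 1)) y
  transmission_right : ∀ n j, j + 1 < N → ∀ y ∈ Set.Ioo 0 Lhat,
    impedanceR k (Ex (n + 1) j) (Ey (n + 1) j) (rightEnd a₁ δ L j) y
      = impedanceR k (Ex n (j + 1)) (Ey n (j + 1)) (rightEnd a₁ δ L j) y
  boundary_left : 0 < N → ∀ n, ∀ y ∈ Set.Ioo 0 Lhat,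
    impedanceL k (Ex (n + 1) 0) (Ey (n + 1) 0) (leftEnd a₁ L 0) y = 0
  boundary_right : ∀ n j, j + 1 = N → ∀ y ∈ Set.Ioo 0 Lhat,
    impedanceR k (Ex (n + 1) j) (Ey (n + 1) j) (rightEnd a₁ δ L j) y = 0

/-- Cosine coefficient (up to the factor `2 / Lhat`) of a function on `(0, Lhat)`. -/
def cosCoeff (Lhat κ : ℝ) (f : ℝ → ℂ) : ℂ :=
  ∫ y in (0 : ℝ)..Lhat, f y * (Real.cos (κ * y) : ℂ)

/-- The interface data of the Fourier mode `κ` after `n` iterations. Block `j` belongs to the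
overlap of subdomains `j` and `j + 1`; its entries are the coefficient of the right impedance data
which subdomain `j + 1` hands to subdomain `j`, and minus the coefficient of the left impedance
data which subdomain `j` hands to subdomain `j + 1`. (The sign corresponds to the Robin
data `±∂ₓv + (i k + σ) v` of the sine coefficient `v` of `E_x`, of which these are multiples by the
common factor `i k / κ`.) -/
def interfaceData (k δ L Lhat a₁ κ : ℝ) (N : ℕ) (Ex Ey : ℕ → ℕ → ℝ → ℝ → ℂ) (n : ℕ) :
    Fin (N - 1) × Fin 2 → ℂ :=
  fun p =>
    if p.2 = 0 then
      cosCoeff Lhat κ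
        (impedanceR k (Ex n (p.1 + 1)) (Ey n (p.1 + 1)) (rightEnd a₁ δ L p.1))
    else
      -cosCoeff Lhat κ (impedanceL k (Ex n p.1) (Ey n p.1) (leftEnd a₁ L (p.1 + 1)))

end

/-! In units of the wave number, `a` and `b` depend only on `κ / k`, `σ₀`, `δ₀` and `L₀`, so every
mode is a mode of the problem with wave number `1`.

Up to two discarded output entries, the iteration matrix acts as independent copies of `[[a, b], [b,
a]]`, which is diagonal in the orthogonal basis `(1, 1)`, `(1, -1)` with eigenvalues `a ± b`. Hence
its Euclidean operator norm, and with it the spectral radius, is at most `limitFactor a b`, the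
larger of `‖a + b‖` and `‖a - b‖`, for every number of subdomains
(`norm_schwarzToeplitz_mulVec_le`). Conversely, discrete sine waves of low frequency give
eigenvalues that approach `a + b` and `a - b` as the number of subdomains grows
(`eventually_exists_mem_spectrum`). So `limitFactor a b` is the limit of the spectral radii.

As a function of a real Fourier number this factor is continuous and vanishes at infinity, so it has
a maximum, which serves as the bound. The scaled Fourier numbers become dense in the positive
half-line as the wave number grows, so the bound is attained in the limit; and it is below `1` as
soon as every single mode factor is.

With `E = exp (-ζ L)` and `G` the reflection coefficient times `exp (-2 ζ δ)`, one has `a ± b = (E ∓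
G) / (1 ∓ G E)`. That these have modulus below `1` becomes a comparison of oscillatory with
hyperbolic terms in `ζ = x + i y` (`limitFactor_schwarz_lt_one`). It holds for all `δ` and `L` if
`κ² ≥ 1` or `σ ≥ 1` (`oscillation_le_damping`). For the remaining modes `x` is bounded below and `y`
above, and a large `δ` or `L` lets the hyperbolic side win.

For the link with the Schwarz method, the sine coefficient `v` of `E_x` and the cosine coefficient
`w` of `E_y` satisfy `v' = κ w` and `κ w' = ζ² v`. The impedance data are then multiples of the
Robin data `v' ± α v` of solutions of `v'' = ζ² v`, and eliminating the two free constants produces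
`a` and `b`. -/

/-! ### The block Toeplitz matrix: action, norm bound, eigenvalues -/

/-- The action of the matrix on a vector given by two sequences, the first vanishing at `m` and the
second at `0`. -/
lemma schwarzToeplitz_mulVec (a b : ℂ) (m : ℕ) (v : Fin m × Fin 2 → ℂ) (U W : ℕ → ℂ)
    (hU : U m = 0) (hW : W 0 = 0) (hv0 : ∀ j : Fin m, v (j, 0) = U j)
    (hv1 : ∀ j : Fin m, v (j, 1) = W (j + 1)) (j : Fin m) :
    (schwarzToeplitz a b m).mulVec v (j, 0) = b * W (j + 1) + a * U (j + 1) ∧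
      (schwarzToeplitz a b m).mulVec v (j, 1) = b * U j + a * W j := by
  have e00 : ∀ q : Fin m, schwarzToeplitz a b m (j, 0) (q, 0)
      = if (j : ℕ) + 1 = q then a else 0 := by
    intro q
    rcases eq_or_ne j q with rfl | h
    · simp [schwarzToeplitz]
    · by_cases h1 : (j : ℕ) + 1 = q <;> simp [schwarzToeplitz, h, h1]
  have e01 : ∀ q : Fin m, schwarzToeplitz a b m (j, 0) (q, 1) = if j = q then b else 0 := by
    intro q
    rcases eq_or_ne j q with rfl | h
    · simp [schwarzToeplitz]
    · by_cases h1 : (j : ℕ) + 1 = q <;> simp [schwarzToeplitz, h, h1]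
  have e10 : ∀ q : Fin m, schwarzToeplitz a b m (j, 1) (q, 0) = if j = q then b else 0 := by
    intro q
    rcases eq_or_ne j q with rfl | h
    · simp [schwarzToeplitz]
    · by_cases h1 : (j : ℕ) + 1 = q <;> simp [schwarzToeplitz, h, h1]
  have e11 : ∀ q : Fin m, schwarzToeplitz a b m (j, 1) (q, 1)
      = if (q : ℕ) + 1 = j then a else 0 := by
    intro q
    rcases eq_or_ne j q with rfl | h
    · simp [schwarzToeplitz]
    · by_cases h1 : (j : ℕ) + 1 = q
      · have : ¬ ((q : ℕ) + 1 = j) := by omega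
        simp [schwarzToeplitz, h, h1, this]
      · by_cases h2 : (q : ℕ) + 1 = j <;> simp [schwarzToeplitz, h, h1, h2]
  constructor
  · simp only [Matrix.mulVec, dotProduct, Fintype.sum_prod_type, Fin.sum_univ_two, e00, e01, hv0,
      hv1, Finset.sum_add_distrib, ite_mul, zero_mul, Finset.sum_ite_eq, Finset.mem_univ, if_true]
    rw [add_comm]
    congr 1
    by_cases h : (j : ℕ) + 1 < m
    · rw [Finset.sum_eq_single (⟨j + 1, h⟩ : Fin m)]
      · simp
      · intro q _ hq
        rw [if_neg]
        intro h'
        exact hq (Fin.ext h'.symm)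
      · simp
    · have : (j : ℕ) + 1 = m := by omega
      rw [this, hU, mul_zero]
      refine Finset.sum_eq_zero fun q _ => if_neg ?_
      omega
  · simp only [Matrix.mulVec, dotProduct, Fintype.sum_prod_type, Fin.sum_univ_two, e10, e11, hv0,
      hv1, Finset.sum_add_distrib, ite_mul, zero_mul, Finset.sum_ite_eq, Finset.mem_univ, if_true]
    congr 1
    rcases Nat.eq_zero_or_pos (j : ℕ) with h | h
    · rw [h, hW, mul_zero]
      exact Finset.sum_eq_zero fun q _ => if_neg (by omega)
    · rw [Finset.sum_eq_single (⟨j - 1, by omega⟩ : Fin m)]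
      · have : (j : ℕ) - 1 + 1 = j := by omega
        simp [this]
      · intro q _ hq
        rw [if_neg]
        intro h'
        exact hq (Fin.ext (by simp; omega))
      · simp

/-- The convergence factor for an infinite number of subdomains. -/
noncomputable def limitFactor (a b : ℂ) : ℝ := max ‖a + b‖ ‖a - b‖

lemma limitFactor_nonneg (a b : ℂ) : 0 ≤ limitFactor a b :=
  (norm_nonneg _).trans (le_max_left _ _)

/-- The vectors `(1, 1)` and `(1, -1)` are orthogonal eigenvectors of `[[a, b], [b, a]]` for `a + b`
and `a - b`; the parallelogram law expresses the norms in these coordinates. -/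
lemma sq_norm_cross_le (a b u w : ℂ) :
    ‖b * w + a * u‖ ^ 2 + ‖b * u + a * w‖ ^ 2
      ≤ limitFactor a b ^ 2 * (‖u‖ ^ 2 + ‖w‖ ^ 2) := by
  have p := fun x y : ℂ => parallelogram_law_with_norm ℝ x y
  have h1 := p (b * w + a * u) (b * u + a * w)
  have h2 := p u w
  have e1 : b * w + a * u + (b * u + a * w) = (a + b) * (u + w) := by ring
  have e2 : b * w + a * u - (b * u + a * w) = (a - b) * (u - w) := by ring
  rw [e1, e2, norm_mul, norm_mul] at h1
  have h3 : ‖a + b‖ ^ 2 ≤ limitFactor a b ^ 2 :=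
    pow_le_pow_left₀ (norm_nonneg _) (le_max_left _ _) 2
  have h4 : ‖a - b‖ ^ 2 ≤ limitFactor a b ^ 2 :=
    pow_le_pow_left₀ (norm_nonneg _) (le_max_right _ _) 2
  have h5 := mul_le_mul_of_nonneg_right h3 (sq_nonneg ‖u + w‖)
  have h6 := mul_le_mul_of_nonneg_right h4 (sq_nonneg ‖u - w‖)
  nlinarith

lemma norm_schwarzToeplitz_mulVec_le (a b : ℂ) (m : ℕ) (v : Fin m × Fin 2 → ℂ) :
    ‖WithLp.toLp 2 ((schwarzToeplitz a b m).mulVec v)‖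
      ≤ limitFactor a b * ‖WithLp.toLp 2 v‖ := by
  obtain ⟨U, hU, hU'⟩ : ∃ U : ℕ → ℂ, U m = 0 ∧ ∀ j : Fin m, v (j, 0) = U j :=
    ⟨fun j => if h : j < m then v (⟨j, h⟩, 0) else 0, by simp, fun j => by simp⟩
  obtain ⟨W, hW, hW'⟩ : ∃ W : ℕ → ℂ, W 0 = 0 ∧ ∀ j : Fin m, v (j, 1) = W (j + 1) :=
    ⟨fun j => if h : 0 < j ∧ j - 1 < m then v (⟨j - 1, h.2⟩, 1) else 0, by simp, fun j => by simp⟩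
  have key := schwarzToeplitz_mulVec a b m v U W hU hW hU' hW'
  refine le_of_sq_le_sq ?_ (by positivity [limitFactor_nonneg a b])
  rw [mul_pow, EuclideanSpace.norm_sq_eq, EuclideanSpace.norm_sq_eq]
  simp only [Fintype.sum_prod_type, Fin.sum_univ_two, (key _).1, (key _).2, hU', hW']
  have s1 := Fin.sum_univ_eq_sum_range
    (fun j => ‖b * W (j + 1) + a * U (j + 1)‖ ^ 2 + ‖b * U j + a * W j‖ ^ 2) m
  have s2 := Fin.sum_univ_eq_sum_range (fun j => ‖U j‖ ^ 2 + ‖W (j + 1)‖ ^ 2) m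
  rw [s1, s2]
  -- The pairs `(U j, W j)` for `j = 0, …, m` give one output entry too many at either end: the
  -- first at `j = 0` and the second at `j = m`. These are nonnegative terms and can be dropped.
  have t := Finset.sum_le_sum fun j (_ : j ∈ Finset.range (m + 1)) =>
    sq_norm_cross_le a b (U j) (W j)
  rw [← Finset.mul_sum] at t
  simp only [Finset.sum_add_distrib] at t ⊢
  rw [Finset.sum_range_succ' (fun j => ‖b * W j + a * U j‖ ^ 2),
    Finset.sum_range_succ (fun j => ‖b * U j + a * W j‖ ^ 2),
    Finset.sum_range_succ (fun j => ‖U j‖ ^ 2), Finset.sum_range_succ' (fun j => ‖W j‖ ^ 2)] at t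
  simp only [hU, hW, norm_zero] at t
  have := sq_nonneg ‖b * 0 + a * U 0‖
  have := sq_nonneg ‖b * 0 + a * W m‖
  simp only [ne_eq, OfNat.ofNat_ne_zero, not_false_eq_true, zero_pow, add_zero] at t
  linarith

/-! ### Eigenvalues and the limit of the spectral radius -/

lemma mem_spectrum_matrix_iff {n : Type*} [Fintype n] [DecidableEq n] (A : Matrix n n ℂ) (μ : ℂ) :
    μ ∈ spectrum ℂ A ↔ ∃ v : n → ℂ, v ≠ 0 ∧ A.mulVec v = μ • v := by
  rw [← Matrix.spectrum_toLin', ← Module.End.hasEigenvalue_iff_mem_spectrum]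
  constructor
  · intro h
    obtain ⟨v, hv⟩ := h.exists_hasEigenvector
    exact ⟨v, hv.2, by simpa using hv.apply_eq_smul⟩
  · rintro ⟨v, hv, h⟩
    exact Module.End.hasEigenvalue_of_hasEigenvector
      (Module.End.hasEigenvector_iff.mpr ⟨Module.End.mem_eigenspace_iff.mpr (by simpa using h), hv⟩)

lemma spectralRadius_schwarzToeplitz_le (a b : ℂ) (m : ℕ) :
    spectralRadius ℂ (schwarzToeplitz a b m) ≤ ENNReal.ofReal (limitFactor a b) := by
  refine iSup₂_le fun μ hμ => ?_
  obtain ⟨v, hv, h⟩ := (mem_spectrum_matrix_iff _ _).1 hμ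
  have h1 := norm_schwarzToeplitz_mulVec_le a b m v
  rw [h, WithLp.toLp_smul, norm_smul] at h1
  have h2 : 0 < ‖WithLp.toLp 2 v‖ := by
    rw [norm_pos_iff]
    simpa using hv
  have h3 : ‖μ‖ ≤ limitFactor a b := le_of_mul_le_mul_right h1 h2
  change ‖μ‖ₑ ≤ _
  rw [← ofReal_norm]
  exact ENNReal.ofReal_le_ofReal h3

/-- An explicit eigenvector. -/
lemma mem_spectrum_schwarzToeplitz {a b μ θ : ℂ} {m : ℕ} (hm : 0 < m) (hb : b ≠ 0)
    (hθ : Complex.sin θ ≠ 0) (h1 : μ ^ 2 - 2 * a * μ * Complex.cos θ + a ^ 2 - b ^ 2 = 0)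
    (h2 : μ * Complex.sin ((m + 1) * θ) = a * Complex.sin (m * θ)) :
    μ ∈ spectrum ℂ (schwarzToeplitz a b m) := by
  rw [mem_spectrum_matrix_iff]
  -- With `W` a sine wave, the second row of each block forces this `U`. The first row then becomes
  -- the dispersion relation `h1`, and the end condition `U m = 0` is `h2`; `W 0 = 0` is automatic.
  let U : ℕ → ℂ := fun j => μ * Complex.sin ((j + 1) * θ) - a * Complex.sin (j * θ)
  let W : ℕ → ℂ := fun j => b * Complex.sin (j * θ)
  let v : Fin m × Fin 2 → ℂ := fun p => if p.2 = 0 then U p.1 else W (p.1 + 1)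
  have key := schwarzToeplitz_mulVec a b m v U W (by simp [U, h2]) (by simp [W])
    (fun j => by simp [v]) (fun j => by simp [v])
  refine ⟨v, fun h => ?_, ?_⟩
  · have := congrFun h (⟨0, hm⟩, 1)
    simp [v, W, hb, hθ] at this
  · ext ⟨j, s⟩
    fin_cases s
    · refine (key j).1.trans ?_
      change b * W (j + 1) + a * U (j + 1) = μ * U j
      simp only [U, W]
      push_cast
      have e1 : ((j : ℂ) + 1 + 1) * θ = (j + 1) * θ + θ := by ring
      have e2 : (j : ℂ) * θ = (j + 1) * θ - θ := by ring
      rw [e1, e2, Complex.sin_add, Complex.sin_sub]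
      linear_combination (-Complex.sin ((j + 1) * θ)) * h1
    · refine (key j).2.trans ?_
      change b * U j + a * W j = μ * W (j + 1)
      simp only [U, W]
      push_cast
      ring

/-- Without a zero, the maximum principle for `1 / f` would bound `‖f z₀‖` below by `ε`. -/
lemma exists_zero_of_norm_lt_sphere {f : ℂ → ℂ} {z₀ : ℂ} {r ε : ℝ} (hr : 0 < r) (hε : 0 < ε)
    (hf : DifferentiableOn ℂ f (Metric.closedBall z₀ r)) (h0 : ‖f z₀‖ < ε)
    (h1 : ∀ z ∈ Metric.sphere z₀ r, ε ≤ ‖f z‖) : ∃ z ∈ Metric.closedBall z₀ r, f z = 0 := by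
  by_contra! h
  have hd : DiffContOnCl ℂ (fun z => (f z)⁻¹) (Metric.ball z₀ r) := by
    refine DifferentiableOn.diffContOnCl ?_
    rw [closure_ball _ hr.ne']
    exact hf.inv h
  have := Complex.norm_le_of_forall_mem_frontier_norm_le Metric.isBounded_ball hd (C := ε⁻¹)
    (fun z hz => by
      rw [frontier_ball _ hr.ne'] at hz
      rw [norm_inv]
      exact inv_anti₀ hε (h1 z hz)) (subset_closure (Metric.mem_ball_self hr))
  rw [norm_inv] at this
  have h2 : 0 < ‖f z₀‖ := norm_pos_iff.2 (h _ (Metric.mem_closedBall_self hr.le))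
  exact absurd ((inv_le_inv₀ h2 hε).1 this) (not_le.2 h0)

/-- The branch, analytic near `θ = 0`, of the eigenvalues of the symbol. -/
noncomputable def symbolBranch (a c θ : ℂ) : ℂ :=
  a * Complex.cos θ + c * Complex.sqrt (1 - (a / c * Complex.sin θ) ^ 2)

lemma symbolBranch_zero (a c : ℂ) : symbolBranch a c 0 = a + c := by
  simp [symbolBranch]

lemma sqrt_sq' (z : ℂ) : Complex.sqrt z ^ 2 = z := by
  rw [Complex.sqrt, ← Complex.cpow_nat_mul]
  simp

lemma symbolBranch_equation {a c : ℂ} (hc : c ≠ 0) (θ : ℂ) :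
    symbolBranch a c θ ^ 2 - 2 * a * symbolBranch a c θ * Complex.cos θ + a ^ 2 - c ^ 2 = 0 := by
  have h := sqrt_sq' (1 - (a / c * Complex.sin θ) ^ 2)
  have h2 := Complex.sin_sq_add_cos_sq θ
  have h3 : c ^ 2 * (a / c * Complex.sin θ) ^ 2 = a ^ 2 * Complex.sin θ ^ 2 := by
    field_simp
  rw [symbolBranch]
  linear_combination c ^ 2 * h - h3 - a ^ 2 * h2

lemma differentiableAt_symbolBranch {a c θ : ℂ}
    (h : 1 - (a / c * Complex.sin θ) ^ 2 ∈ Complex.slitPlane) :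
    DifferentiableAt ℂ (symbolBranch a c) θ := by
  unfold symbolBranch
  fun_prop (disch := exact h)

lemma sin_ne_zero_of_re {θ : ℂ} (h0 : 0 < θ.re) (h1 : θ.re < Real.pi) : Complex.sin θ ≠ 0 := by
  rw [Ne, Complex.sin_eq_zero_iff]
  rintro ⟨k, rfl⟩
  have e : ((k : ℂ) * (Real.pi : ℂ)).re = k * Real.pi := by simp
  rw [e] at h0 h1
  have hp := Real.pi_pos
  have k0 : (0 : ℝ) < k := pos_of_mul_pos_left h0 hp.le
  have k1 : (k : ℝ) < 1 := by
    by_contra! h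
    nlinarith
  norm_cast at k0 k1
  omega

lemma sin_ne_zero_of_mem_sphere {φ : ℂ} (h : φ ∈ Metric.sphere (Real.pi : ℂ) 1) :
    Complex.sin φ ≠ 0 := by
  rw [Ne, Complex.sin_eq_zero_iff]
  rintro ⟨k, rfl⟩
  rw [mem_sphere_iff_norm] at h
  have e : (k : ℂ) * (Real.pi : ℂ) - Real.pi = (((k - 1 : ℤ) : ℝ) * Real.pi : ℝ) := by
    push_cast
    ring
  rw [e, Complex.norm_real, norm_mul, Real.norm_of_nonneg Real.pi_pos.le] at h
  have hp := Real.pi_gt_three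
  rcases eq_or_ne (k - 1) 0 with h0 | h0
  · simp [h0] at h
  · have : (1 : ℝ) ≤ ‖((k - 1 : ℤ) : ℝ)‖ := by
      rw [Real.norm_eq_abs]
      exact_mod_cast Int.one_le_abs h0
    nlinarith

/-- Put `θ = φ / m` in the end condition of the sine eigenvector. As `m → ∞` it tends to `c sin φ =
0`, whose root `φ = π` persists within distance `1`. Then `θ → 0`, so the eigenvalue tends to `a +
c`. The two choices `c = ± b` give both values of the limit factor. -/
lemma eventually_exists_mem_spectrum {a b c : ℂ} (hc : c ≠ 0) (hcb : c ^ 2 = b ^ 2) {r : ℝ}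
    (hr : r < ‖a + c‖) :
    ∀ᶠ m : ℕ in atTop, ∃ μ ∈ spectrum ℂ (schwarzToeplitz a b m), r < ‖μ‖ := by
  have hb : b ≠ 0 := by
    rintro rfl
    exact hc (by simpa using hcb)
  -- The end condition with `θ = t φ`, where `t` stands for `1 / m`; at `t = 0` it is explicit.
  let H : ℂ → ℂ → ℂ := fun t φ => symbolBranch a c (t * φ) * Complex.sin (φ + t * φ)
    - a * Complex.sin φ
  have hcont : ∀ φ : ℂ, ContinuousAt (fun p : ℂ × ℂ => symbolBranch a c (p.1 * p.2)) (0, φ) := by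
    intro φ
    refine ContinuousAt.comp (g := symbolBranch a c) (f := fun p : ℂ × ℂ => p.1 * p.2) ?_
      (by fun_prop)
    refine (differentiableAt_symbolBranch ?_).continuousAt
    simp
  have hH : ∀ φ : ℂ, ContinuousAt (fun p : ℂ × ℂ => H p.1 p.2) (0, φ) := by
    intro φ
    exact ((hcont φ).mul (by fun_prop)).sub (by fun_prop)
  have hH0 : ∀ φ, H 0 φ = c * Complex.sin φ := by
    intro φ
    simp only [H, zero_mul, symbolBranch_zero, add_zero]
    ring
  obtain ⟨ε, hε, hsph⟩ : ∃ ε : ℝ, 0 < ε ∧ ∀ φ ∈ Metric.sphere (Real.pi : ℂ) 1,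
      ε < ‖H 0 φ‖ := by
    obtain ⟨φ₀, h0, hmin⟩ := (isCompact_sphere (Real.pi : ℂ) 1).exists_isMinOn
      (NormedSpace.sphere_nonempty.2 zero_le_one)
      (f := fun φ => ‖H 0 φ‖) (by
        simp only [hH0]
        fun_prop)
    have : 0 < ‖H 0 φ₀‖ := by
      rw [norm_pos_iff, hH0]
      exact mul_ne_zero hc (sin_ne_zero_of_mem_sphere h0)
    refine ⟨‖H 0 φ₀‖ / 2, by positivity, fun φ hφ => ?_⟩
    have h1 : ‖H 0 φ₀‖ ≤ ‖H 0 φ‖ := hmin hφ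
    linarith
  have ev1 : ∀ᶠ t : ℂ in 𝓝 0, ∀ φ ∈ Metric.sphere (Real.pi : ℂ) 1, ε < ‖H t φ‖ :=
    (isCompact_sphere _ _).eventually_forall_of_forall_eventually fun φ hφ =>
      (hH φ).norm.eventually (lt_mem_nhds (hsph φ hφ))
  have ev2 : ∀ᶠ t : ℂ in 𝓝 0, ‖H t Real.pi‖ < ε := by
    have h1 : ContinuousAt (fun t : ℂ => ‖H t Real.pi‖) 0 :=
      (ContinuousAt.comp (f := fun t : ℂ => (t, (Real.pi : ℂ)))
        (g := fun p : ℂ × ℂ => H p.1 p.2) (hH _) (by fun_prop)).norm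
    refine h1.eventually (gt_mem_nhds ?_)
    simpa [hH0] using hε
  have ev3 : ∀ᶠ t : ℂ in 𝓝 0, ∀ φ ∈ Metric.closedBall (Real.pi : ℂ) 1,
      r < ‖symbolBranch a c (t * φ)‖ :=
    (isCompact_closedBall _ _).eventually_forall_of_forall_eventually fun φ _ =>
      (hcont φ).norm.eventually (lt_mem_nhds (by simpa [symbolBranch_zero] using hr))
  have ev4 : ∀ᶠ t : ℂ in 𝓝 0, ∀ φ ∈ Metric.closedBall (Real.pi : ℂ) 1,
      1 - (a / c * Complex.sin (t * φ)) ^ 2 ∈ Complex.slitPlane :=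
    (isCompact_closedBall _ _).eventually_forall_of_forall_eventually fun φ _ => by
      refine ContinuousAt.eventually_mem (f := fun p : ℂ × ℂ =>
        1 - (a / c * Complex.sin (p.1 * p.2)) ^ 2) (by fun_prop)
        (Complex.isOpen_slitPlane.mem_nhds ?_)
      simp
  have lim : Tendsto (fun m : ℕ => ((m : ℂ))⁻¹) atTop (𝓝 0) :=
    tendsto_inv_atTop_nhds_zero_nat
  filter_upwards [lim.eventually ev1, lim.eventually ev2, lim.eventually ev3, lim.eventually ev4,
    eventually_ge_atTop 2] with m h1 h2 h3 h4 hm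
  obtain ⟨φ, hφ, hz⟩ := exists_zero_of_norm_lt_sphere (f := H (m : ℂ)⁻¹) one_pos hε (by
    intro φ hφ
    refine DifferentiableAt.differentiableWithinAt ?_
    refine (DifferentiableAt.mul ?_ (by fun_prop)).sub (by fun_prop)
    exact DifferentiableAt.comp φ (g := symbolBranch a c) (f := fun φ => (m : ℂ)⁻¹ * φ)
      (differentiableAt_symbolBranch (h4 φ hφ)) (by fun_prop)) h2 (fun z hz => (h1 z hz).le)
  have hm0 : (m : ℂ) ≠ 0 := by
    norm_cast
    omega
  refine ⟨symbolBranch a c ((m : ℂ)⁻¹ * φ), ?_, h3 φ hφ⟩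
  refine mem_spectrum_schwarzToeplitz (θ := (m : ℂ)⁻¹ * φ) (by omega) hb
    ?_ ?_ ?_
  -- The real part of `φ` is within `1` of `π`, so for `m ≥ 2` the real part of `θ` lies strictly
  -- between `0` and `π`.
  · have hre : ((m : ℂ)⁻¹ * φ).re = φ.re / m := by
      have : ((m : ℂ)⁻¹) = ((m : ℝ)⁻¹ : ℝ) := by push_cast; rfl
      rw [this, Complex.re_ofReal_mul]
      ring
    have h5 := (Complex.abs_re_le_norm _).trans (mem_closedBall_iff_norm.1 hφ)
    rw [Complex.sub_re, Complex.ofReal_re, abs_le] at h5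
    have hp := Real.pi_gt_three
    have hm' : (2 : ℝ) ≤ m := by exact_mod_cast hm
    apply sin_ne_zero_of_re
    · rw [hre]
      apply div_pos <;> linarith
    · rw [hre, div_lt_iff₀ (by linarith)]
      nlinarith
  · rw [← hcb]
    exact symbolBranch_equation hc _
  · have e1 : ((m : ℂ) + 1) * ((m : ℂ)⁻¹ * φ) = φ + (m : ℂ)⁻¹ * φ := by
      field_simp
    have e2 : (m : ℂ) * ((m : ℂ)⁻¹ * φ) = φ := by
      field_simp
    rw [e1, e2]
    exact sub_eq_zero.1 hz

lemma tendsto_spectralRadius_schwarzToeplitz {a b : ℂ} (hb : b ≠ 0) :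
    Tendsto (fun m : ℕ => spectralRadius ℂ (schwarzToeplitz a b m)) atTop
      (𝓝 (ENNReal.ofReal (limitFactor a b))) := by
  refine tendsto_order.2 ⟨fun x hx => ?_, fun x hx => Eventually.of_forall fun m =>
    (spectralRadius_schwarzToeplitz_le a b m).trans_lt hx⟩
  have hx' : x.toReal < limitFactor a b :=
    (ENNReal.lt_ofReal_iff_toReal_lt (hx.trans_le le_top).ne).1 hx
  have key : ∀ᶠ m : ℕ in atTop, ∃ μ ∈ spectrum ℂ (schwarzToeplitz a b m), x.toReal < ‖μ‖ := by
    rcases lt_max_iff.1 hx' with h | h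
    · exact eventually_exists_mem_spectrum hb rfl h
    · exact eventually_exists_mem_spectrum (neg_ne_zero.2 hb) (neg_sq b)
        (by simpa [sub_eq_add_neg] using h)
  filter_upwards [key] with m ⟨μ, hμ, h⟩
  refine lt_of_lt_of_le ?_ (le_iSup₂ (f := fun k (_ : k ∈ spectrum ℂ _) => (‖k‖₊ : ℝ≥0∞)) μ hμ)
  change x < ‖μ‖ₑ
  rw [← ofReal_norm]
  exact (ENNReal.lt_ofReal_iff_toReal_lt (hx.trans_le le_top).ne).2 h

/-! ### The square root `ζ` -/

lemma maxwellZeta_sq (k σ κ : ℝ) :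
    maxwellZeta k σ κ ^ 2 = Complex.I * k * σ + (κ : ℂ) ^ 2 - (k : ℂ) ^ 2 := sqrt_sq' _

lemma maxwellZeta_re_sq (k σ κ : ℝ) :
    (maxwellZeta k σ κ).re ^ 2 - (maxwellZeta k σ κ).im ^ 2 = κ ^ 2 - k ^ 2 := by
  have h := congrArg Complex.re (maxwellZeta_sq k σ κ)
  simp [pow_two] at h
  linarith

lemma maxwellZeta_re_mul_im (k σ κ : ℝ) :
    2 * (maxwellZeta k σ κ).re * (maxwellZeta k σ κ).im = k * σ := by
  have h := congrArg Complex.im (maxwellZeta_sq k σ κ)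
  simp [pow_two] at h
  linarith

lemma maxwellZeta_re_pos {k σ : ℝ} (hk : 0 < k) (hσ : 0 < σ) (κ : ℝ) :
    0 < (maxwellZeta k σ κ).re := by
  have h0 : 0 ≤ (maxwellZeta k σ κ).re := by
    rw [maxwellZeta, Complex.sqrt, Complex.cpow_inv_two_re]
    positivity
  refine lt_of_le_of_ne h0 fun h => ?_
  have := maxwellZeta_re_mul_im k σ κ
  rw [← h] at this
  nlinarith [mul_pos hk hσ]

lemma maxwellZeta_im_pos {k σ : ℝ} (hk : 0 < k) (hσ : 0 < σ) (κ : ℝ) :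
    0 < (maxwellZeta k σ κ).im := by
  have h := maxwellZeta_re_mul_im k σ κ
  have h1 := maxwellZeta_re_pos hk hσ κ
  by_contra! h2
  nlinarith [mul_pos hk hσ]

lemma eq_of_sq_eq_of_re_pos {z w : ℂ} (h : z ^ 2 = w ^ 2) (hz : 0 < z.re) (hw : 0 < w.re) :
    z = w := by
  rcases sq_eq_sq_iff_eq_or_eq_neg.1 h with h | h
  · exact h
  · rw [h, Complex.neg_re] at hz
    linarith

/-- Both sides have the same square and positive real part. Together with the invariance of `a` and
`b` under scaling, this removes the wave number from the problem. -/
lemma maxwellZeta_scale {k σ : ℝ} (hk : 0 < k) (hσ : 0 < σ) (κ : ℝ) :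
    maxwellZeta k (σ * k) κ = k * maxwellZeta 1 σ (κ / k) := by
  refine eq_of_sq_eq_of_re_pos ?_ (maxwellZeta_re_pos hk (mul_pos hσ hk) κ) ?_
  · rw [mul_pow, maxwellZeta_sq, maxwellZeta_sq]
    have : (k : ℂ) ≠ 0 := by exact_mod_cast hk.ne'
    push_cast
    field_simp
  · rw [Complex.re_ofReal_mul]
    exact mul_pos hk (maxwellZeta_re_pos one_pos hσ _)

lemma continuous_maxwellZeta {k σ : ℝ} (hk : 0 < k) (hσ : 0 < σ) :
    Continuous (maxwellZeta k σ) := by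
  refine continuous_iff_continuousAt.2 fun κ => ?_
  refine ContinuousAt.comp (g := Complex.sqrt)
    (f := fun κ : ℝ => Complex.I * k * σ + (κ : ℂ) ^ 2 - (k : ℂ) ^ 2) ?_ (by fun_prop)
  refine Complex.continuousAt_sqrt (Or.inr ?_)
  simp [pow_two, hk.ne', hσ.ne']

lemma tendsto_maxwellZeta_re {σ : ℝ} (hσ : 0 < σ) :
    Tendsto (fun κ : ℝ => (maxwellZeta 1 σ κ).re) (cocompact ℝ) atTop := by
  have h : Tendsto (fun κ : ℝ => ‖κ‖ + (-1)) (cocompact ℝ) atTop :=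
    tendsto_atTop_add_const_right _ _ (tendsto_norm_cocompact_atTop (E := ℝ))
  refine tendsto_atTop_mono (fun κ => ?_) h
  have h1 := maxwellZeta_re_sq 1 σ κ
  have h2 := maxwellZeta_re_pos one_pos hσ κ
  have h3 := sq_abs κ
  rw [Real.norm_eq_abs]
  by_contra! h4
  nlinarith [sq_nonneg (maxwellZeta 1 σ κ).im]

/-! ### The coefficients `a` and `b` -/

/-- The reflection coefficient of the transmission condition. -/
noncomputable def reflection (ζ α : ℂ) : ℂ := (ζ - α) / (ζ + α)

lemma schwarzA_scale {k : ℝ} (hk : 0 < k) (ζ α : ℂ) (δ L : ℝ) :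
    schwarzA (k * ζ) (k * α) (δ / k) (L / k) = schwarzA ζ α δ L := by
  have h : (k : ℂ) ≠ 0 := by exact_mod_cast hk.ne'
  unfold schwarzA schwarzD
  have e1 : (k : ℂ) * ζ * (2 * ((δ / k : ℝ) : ℂ) + ((L / k : ℝ) : ℂ)) = ζ * (2 * δ + L) := by
    push_cast; field_simp
  have e2 : -((k : ℂ) * ζ) * (2 * ((δ / k : ℝ) : ℂ) + ((L / k : ℝ) : ℂ)) = -ζ * (2 * δ + L) := by
    push_cast; field_simp
  have e3 : 2 * ((k : ℂ) * ζ) * ((δ / k : ℝ) : ℂ) = 2 * ζ * δ := by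
    push_cast; field_simp
  rw [e1, e2, e3]
  conv_rhs => rw [← mul_div_mul_left _ _ (pow_ne_zero 2 h)]
  congr 1 <;> ring

lemma schwarzB_scale {k : ℝ} (hk : 0 < k) (ζ α : ℂ) (δ L : ℝ) :
    schwarzB (k * ζ) (k * α) (δ / k) (L / k) = schwarzB ζ α δ L := by
  have h : (k : ℂ) ≠ 0 := by exact_mod_cast hk.ne'
  unfold schwarzB schwarzD
  have e1 : (k : ℂ) * ζ * (2 * ((δ / k : ℝ) : ℂ) + ((L / k : ℝ) : ℂ)) = ζ * (2 * δ + L) := by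
    push_cast; field_simp
  have e2 : -((k : ℂ) * ζ) * (2 * ((δ / k : ℝ) : ℂ) + ((L / k : ℝ) : ℂ)) = -ζ * (2 * δ + L) := by
    push_cast; field_simp
  have e3 : (k : ℂ) * ζ * ((L / k : ℝ) : ℂ) = ζ * L := by
    push_cast; field_simp
  have e4 : -((k : ℂ) * ζ) * ((L / k : ℝ) : ℂ) = -ζ * L := by
    push_cast; field_simp
  rw [e1, e2, e3, e4]
  conv_rhs => rw [← mul_div_mul_left _ _ (pow_ne_zero 2 h)]
  congr 1 <;> ring

section coefficients

variable {ζ α : ℂ} {δ L : ℝ}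

/-- Extracting the growing exponentials leaves only `exp (-ζ L)` and the damped reflection
coefficient, both of modulus below `1`; hence the denominator does not vanish. -/
lemma schwarzD_eq (h : ζ + α ≠ 0) :
    schwarzD ζ α δ L = (ζ + α) ^ 2 / (Complex.exp (-(2 * ζ * δ)) * Complex.exp (-(ζ * L))) *
      (1 - (reflection ζ α * Complex.exp (-(2 * ζ * δ)) * Complex.exp (-(ζ * L))) ^ 2) := by
  have e1 : Complex.exp (ζ * (2 * δ + L))
      = (Complex.exp (-(2 * ζ * δ)) * Complex.exp (-(ζ * L)))⁻¹ := by
    rw [← Complex.exp_add, ← Complex.exp_neg]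
    congr 1
    ring
  have e2 : Complex.exp (-ζ * (2 * δ + L))
      = Complex.exp (-(2 * ζ * δ)) * Complex.exp (-(ζ * L)) := by
    rw [← Complex.exp_add]
    congr 1
    ring
  have h1 := Complex.exp_ne_zero (-(2 * ζ * δ))
  have h2 := Complex.exp_ne_zero (-(ζ * L))
  rw [schwarzD, e1, e2, reflection]
  field_simp

lemma schwarzA_eq (h : ζ + α ≠ 0) :
    schwarzA ζ α δ L = Complex.exp (-(ζ * L)) *
        (1 - (reflection ζ α * Complex.exp (-(2 * ζ * δ))) ^ 2) /
      (1 - (reflection ζ α * Complex.exp (-(2 * ζ * δ)) * Complex.exp (-(ζ * L))) ^ 2) := by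
  have e1 : Complex.exp (2 * ζ * δ) = (Complex.exp (-(2 * ζ * δ)))⁻¹ := by
    rw [← Complex.exp_neg, neg_neg]
  have h1 := Complex.exp_ne_zero (-(2 * ζ * δ))
  have h2 := Complex.exp_ne_zero (-(ζ * L))
  have hne : (ζ + α) ^ 2 / (Complex.exp (-(2 * ζ * δ)) * Complex.exp (-(ζ * L))) ≠ 0 := by
    positivity
  rw [schwarzA, schwarzD_eq h, ← mul_div_mul_left _ (1 - _) hne, e1]
  congr 1
  rw [reflection]
  field_simp

lemma schwarzB_eq (h : ζ + α ≠ 0) :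
    schwarzB ζ α δ L = -(reflection ζ α * Complex.exp (-(2 * ζ * δ))) *
        (1 - Complex.exp (-(ζ * L)) ^ 2) /
      (1 - (reflection ζ α * Complex.exp (-(2 * ζ * δ)) * Complex.exp (-(ζ * L))) ^ 2) := by
  have e1 : Complex.exp (ζ * L) = (Complex.exp (-(ζ * L)))⁻¹ := by
    rw [← Complex.exp_neg, neg_neg]
  have h1 := Complex.exp_ne_zero (-(2 * ζ * δ))
  have h2 := Complex.exp_ne_zero (-(ζ * L))
  have hne : (ζ + α) ^ 2 / (Complex.exp (-(2 * ζ * δ)) * Complex.exp (-(ζ * L))) ≠ 0 := by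
    positivity
  rw [schwarzB, schwarzD_eq h, ← mul_div_mul_left _ (1 - _) hne, e1, neg_mul ζ]
  congr 1
  rw [reflection]
  field_simp
  ring

/-- Both numbers lie in the open first quadrant, so `|ζ + α|² - |ζ - α|² = 4 (Re ζ Re α + Im ζ Im
α)` is positive. -/
lemma norm_reflection_lt_one (hζ : 0 < ζ.re) (hζ' : 0 < ζ.im) (hα : 0 < α.re) (hα' : 0 < α.im) :
    ‖reflection ζ α‖ < 1 := by
  have h : ζ + α ≠ 0 := by
    intro h
    have := congrArg Complex.re h
    simp at this
    linarith
  rw [reflection, norm_div, div_lt_one (norm_pos_iff.2 h)]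
  refine lt_of_pow_lt_pow_left₀ 2 (norm_nonneg _) ?_
  rw [← Complex.normSq_eq_norm_sq, ← Complex.normSq_eq_norm_sq, Complex.normSq_apply,
    Complex.normSq_apply]
  simp only [Complex.sub_re, Complex.sub_im, Complex.add_re, Complex.add_im]
  nlinarith [mul_pos hζ hα, mul_pos hζ' hα']

lemma norm_exp_neg_mul_lt_one {r : ℝ} (hζ : 0 < ζ.re) (hr : 0 < r) :
    ‖Complex.exp (-(ζ * r))‖ < 1 := by
  rw [Complex.norm_exp, Complex.neg_re, Complex.re_mul_ofReal, Real.exp_lt_one_iff]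
  nlinarith [mul_pos hζ hr]

lemma norm_reflection_mul_exp_lt_one (hζ : 0 < ζ.re) (hζ' : 0 < ζ.im) (hα : 0 < α.re)
    (hα' : 0 < α.im) (hδ : 0 < δ) : ‖reflection ζ α * Complex.exp (-(2 * ζ * δ))‖ < 1 := by
  rw [norm_mul]
  have e : 2 * ζ * δ = ζ * ((2 * δ : ℝ) : ℂ) := by
    push_cast
    ring
  rw [e]
  exact mul_lt_one_of_nonneg_of_lt_one_left (norm_nonneg _) (norm_reflection_lt_one hζ hζ' hα hα')
    (norm_exp_neg_mul_lt_one hζ (by positivity)).le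

lemma one_sub_ne_zero_of_norm_lt {z : ℂ} (h : ‖z‖ < 1) : 1 - z ≠ 0 := by
  intro h0
  rw [← sub_eq_zero.1 h0] at h
  simp at h

lemma one_sub_mul_sq_ne_zero {E G : ℂ} (hE : ‖E‖ < 1) (hG : ‖G‖ < 1) : 1 - (G * E) ^ 2 ≠ 0 := by
  apply one_sub_ne_zero_of_norm_lt
  rw [norm_pow, norm_mul]
  exact pow_lt_one₀ (by positivity)
    (mul_lt_one_of_nonneg_of_lt_one_left (norm_nonneg _) hG hE.le) two_ne_zero

lemma add_ne_zero_of_re_pos (hζ : 0 < ζ.re) (hα : 0 < α.re) : ζ + α ≠ 0 := by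
  intro h
  have := congrArg Complex.re h
  simp at this
  linarith

lemma schwarzD_ne_zero (hζ : 0 < ζ.re) (hζ' : 0 < ζ.im) (hα : 0 < α.re)
    (hα' : 0 < α.im) (hδ : 0 < δ) (hL : 0 < L) : schwarzD ζ α δ L ≠ 0 := by
  have h := add_ne_zero_of_re_pos hζ hα
  rw [schwarzD_eq h]
  have := one_sub_mul_sq_ne_zero (norm_exp_neg_mul_lt_one hζ hL)
    (norm_reflection_mul_exp_lt_one hζ hζ' hα hα' hδ)
  have h1 := Complex.exp_ne_zero (-(2 * ζ * δ))
  have h2 := Complex.exp_ne_zero (-(ζ * L))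
  positivity

lemma schwarzB_ne_zero (hζ : 0 < ζ.re) (hζ' : 0 < ζ.im) (hα : 0 < α.re)
    (hα' : 0 < α.im) (hδ : 0 < δ) (hL : 0 < L) (hne : ζ ^ 2 ≠ α ^ 2) : schwarzB ζ α δ L ≠ 0 := by
  have h := add_ne_zero_of_re_pos hζ hα
  have hE := norm_exp_neg_mul_lt_one hζ hL
  have hsub : ζ - α ≠ 0 := fun h0 => hne (by rw [sub_eq_zero.1 h0])
  rw [schwarzB_eq h]
  refine div_ne_zero (mul_ne_zero (neg_ne_zero.2 (mul_ne_zero (div_ne_zero hsub h)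
    (Complex.exp_ne_zero _))) (one_sub_ne_zero_of_norm_lt ?_)) (one_sub_mul_sq_ne_zero hE
      (norm_reflection_mul_exp_lt_one hζ hζ' hα hα' hδ))
  rw [norm_pow]
  exact pow_lt_one₀ (norm_nonneg _) hE two_ne_zero

end coefficients

/-! ### Criterion for a limit factor below one -/

/-- This rests on the identity `|1 + G E|² - |E + G|² = (1 - |E|²) (1 - |G|²) - 4 Im G Im E`. -/
lemma norm_add_lt_norm_one_add {E G : ℂ}
    (h : 4 * (G.im * E.im) < (1 - ‖E‖ ^ 2) * (1 - ‖G‖ ^ 2)) :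
    ‖E + G‖ < ‖1 + G * E‖ := by
  refine lt_of_pow_lt_pow_left₀ 2 (norm_nonneg _) ?_
  rw [← Complex.normSq_eq_norm_sq, ← Complex.normSq_eq_norm_sq, Complex.normSq_apply,
    Complex.normSq_apply] at *
  simp only [Complex.add_re, Complex.add_im, Complex.mul_re, Complex.mul_im, Complex.one_re,
    Complex.one_im] at *
  nlinarith

/-- The numerators of `a + b` and `a - b` share a factor with `1 - (G E)²`; after cancellation they
are `(E ∓ G) / (1 ∓ G E)`. -/
lemma limitFactor_lt_one_of_im {E G : ℂ} (hE : ‖E‖ < 1) (hG : ‖G‖ < 1)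
    (h : 4 * (|G.im| * |E.im|) < (1 - ‖E‖ ^ 2) * (1 - ‖G‖ ^ 2)) :
    limitFactor (E * (1 - G ^ 2) / (1 - (G * E) ^ 2)) (-G * (1 - E ^ 2) / (1 - (G * E) ^ 2)) < 1 := by
  have hGE : ‖G * E‖ < 1 := by
    rw [norm_mul]
    exact mul_lt_one_of_nonneg_of_lt_one_left (norm_nonneg _) hG hE.le
  have n1 : 1 - G * E ≠ 0 := one_sub_ne_zero_of_norm_lt hGE
  have n2 : 1 + G * E ≠ 0 := by
    rw [← sub_neg_eq_add]
    exact one_sub_ne_zero_of_norm_lt (by rwa [norm_neg])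
  have n3 : 1 - (G * E) ^ 2 ≠ 0 := one_sub_mul_sq_ne_zero hE hG
  have e1 : E * (1 - G ^ 2) / (1 - (G * E) ^ 2) + -G * (1 - E ^ 2) / (1 - (G * E) ^ 2)
      = (E + -G) / (1 + -G * E) := by
    have : 1 + -G * E ≠ 0 := by simpa [← sub_eq_add_neg] using n1
    rw [← add_div, div_eq_div_iff n3 this]
    ring
  have e2 : E * (1 - G ^ 2) / (1 - (G * E) ^ 2) - -G * (1 - E ^ 2) / (1 - (G * E) ^ 2)
      = (E + G) / (1 + G * E) := by
    rw [← sub_div, div_eq_div_iff n3 n2]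
    ring
  have habs := abs_mul G.im E.im
  rw [limitFactor, e1, e2]
  refine max_lt ?_ ?_
  · have n1' : 1 + -G * E ≠ 0 := by simpa [← sub_eq_add_neg] using n1
    rw [norm_div, div_lt_one (norm_pos_iff.2 n1')]
    apply norm_add_lt_norm_one_add
    rw [norm_neg, Complex.neg_im]
    have := neg_abs_le (G.im * E.im)
    linarith
  · rw [norm_div, div_lt_one (norm_pos_iff.2 n2)]
    apply norm_add_lt_norm_one_add
    have := le_abs_self (G.im * E.im)
    linarith

/-! ### Convergence of a single mode -/

lemma one_sub_norm_exp_neg_sq (ζ : ℂ) (r : ℝ) :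
    1 - ‖Complex.exp (-(ζ * r))‖ ^ 2 = 2 * Real.exp (-(ζ.re * r)) * Real.sinh (ζ.re * r) := by
  have h : Real.exp (ζ.re * r) * Real.exp (-(ζ.re * r)) = 1 := by
    rw [← Real.exp_add, add_neg_cancel, Real.exp_zero]
  rw [Complex.norm_exp, Complex.neg_re, Complex.re_mul_ofReal, Real.sinh_eq]
  linear_combination -h

lemma abs_exp_neg_im (ζ : ℂ) (r : ℝ) :
    |(Complex.exp (-(ζ * r))).im| = Real.exp (-(ζ.re * r)) * |Real.sin (ζ.im * r)| := by
  rw [Complex.exp_im, Complex.neg_re, Complex.neg_im, Complex.re_mul_ofReal,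
    Complex.im_mul_ofReal, Real.sin_neg, abs_mul, abs_neg, Real.abs_exp]

lemma reflection_re_im {ζ α : ℂ} (h : ζ + α ≠ 0) :
    Complex.normSq (ζ + α) * (reflection ζ α).re = Complex.normSq ζ - Complex.normSq α ∧
      Complex.normSq (ζ + α) * (reflection ζ α).im = 2 * (ζ.im * α.re - ζ.re * α.im) := by
  have h1 : Complex.normSq (ζ + α) ≠ 0 := by simpa using h
  rw [reflection, Complex.div_re, Complex.div_im]
  constructor
  · field_simp
    simp only [Complex.sub_re, Complex.sub_im, Complex.add_re, Complex.add_im,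
      Complex.normSq_apply]
    ring
  · field_simp
    simp only [Complex.sub_re, Complex.sub_im, Complex.add_re, Complex.add_im]
    ring

/-- The hypothesis is the criterion on the imaginary parts of `E` and `G`, multiplied by `|ζ + α|²`
and divided by the common positive factor `4 exp (-2 Re ζ δ) exp (-Re ζ L)`. -/
lemma limitFactor_schwarz_lt_one {ζ α : ℂ} {δ L : ℝ} (hζ : 0 < ζ.re) (hζ' : 0 < ζ.im)
    (hα : 0 < α.re) (hα' : 0 < α.im) (hδ : 0 < δ) (hL : 0 < L)
    (h : |Real.sin (ζ.im * L)| *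
        |2 * (ζ.im * α.re - ζ.re * α.im) * Real.cos (2 * ζ.im * δ)
          + (Complex.normSq α - Complex.normSq ζ) * Real.sin (2 * ζ.im * δ)|
      < Real.sinh (ζ.re * L) *
        (2 * (ζ.re * α.re + ζ.im * α.im) * Real.cosh (2 * ζ.re * δ)
          + (Complex.normSq ζ + Complex.normSq α) * Real.sinh (2 * ζ.re * δ))) :
    limitFactor (schwarzA ζ α δ L) (schwarzB ζ α δ L) < 1 := by
  have hne := add_ne_zero_of_re_pos hζ hα
  rw [schwarzA_eq hne, schwarzB_eq hne]
  refine limitFactor_lt_one_of_im (norm_exp_neg_mul_lt_one hζ hL)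
    (norm_reflection_mul_exp_lt_one hζ hζ' hα hα' hδ) ?_
  have hn : 0 < Complex.normSq (ζ + α) := Complex.normSq_pos.2 hne
  obtain ⟨hr, hi⟩ := reflection_re_im hne
  rw [one_sub_norm_exp_neg_sq, abs_exp_neg_im]
  have hre : (-(2 * ζ * (δ : ℂ))).re = -(2 * ζ.re * δ) := by simp
  have him : (-(2 * ζ * (δ : ℂ))).im = -(2 * ζ.im * δ) := by simp
  have hG : Complex.normSq (ζ + α) * |(reflection ζ α * Complex.exp (-(2 * ζ * δ))).im|
      = Real.exp (-(2 * ζ.re * δ)) *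
        |2 * (ζ.im * α.re - ζ.re * α.im) * Real.cos (2 * ζ.im * δ)
          + (Complex.normSq α - Complex.normSq ζ) * Real.sin (2 * ζ.im * δ)| := by
    rw [← abs_of_pos hn, ← abs_mul, ← Real.abs_exp (-(2 * ζ.re * δ)), ← abs_mul, Complex.mul_im,
      Complex.exp_re, Complex.exp_im, hre, him, Real.cos_neg, Real.sin_neg]
    congr 1
    linear_combination (-Real.exp (-(2 * ζ.re * δ)) * Real.sin (2 * ζ.im * δ)) * hr
      + Real.exp (-(2 * ζ.re * δ)) * Real.cos (2 * ζ.im * δ) * hi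
  have hN : Complex.normSq (ζ + α) *
      (1 - ‖reflection ζ α * Complex.exp (-(2 * ζ * δ))‖ ^ 2)
      = 2 * Real.exp (-(2 * ζ.re * δ)) *
        (2 * (ζ.re * α.re + ζ.im * α.im) * Real.cosh (2 * ζ.re * δ)
          + (Complex.normSq ζ + Complex.normSq α) * Real.sinh (2 * ζ.re * δ)) := by
    have e0 : Real.exp (2 * ζ.re * δ) * Real.exp (-(2 * ζ.re * δ)) = 1 := by
      rw [← Real.exp_add, add_neg_cancel, Real.exp_zero]
    have e1 : Complex.normSq (ζ + α) * ‖reflection ζ α‖ ^ 2 = Complex.normSq (ζ - α) := by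
      rw [← Complex.normSq_eq_norm_sq, reflection, Complex.normSq_div]
      field_simp
    rw [norm_mul, mul_pow, Complex.norm_exp, hre, Real.cosh_eq, Real.sinh_eq]
    rw [Complex.normSq_apply] at e1 ⊢
    rw [Complex.normSq_apply] at e1
    simp only [Complex.sub_re, Complex.sub_im, Complex.add_re, Complex.add_im,
      Complex.normSq_apply] at e1 ⊢
    linear_combination (-Real.exp (-(2 * ζ.re * δ)) ^ 2) * e1
      - ((ζ.re + α.re) * (ζ.re + α.re) + (ζ.im + α.im) * (ζ.im + α.im)) * e0
  refine lt_of_mul_lt_mul_left ?_ hn.le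
  have hpos : 0 < 4 * Real.exp (-(2 * ζ.re * δ)) * Real.exp (-(ζ.re * L)) := by positivity
  have := mul_lt_mul_of_pos_left h hpos
  calc _ = 4 * (Complex.normSq (ζ + α) * |(reflection ζ α * Complex.exp (-(2 * ζ * δ))).im|) *
        (Real.exp (-(ζ.re * L)) * |Real.sin (ζ.im * L)|) := by ring
    _ = _ := by rw [hG]
    _ < _ := (by ring_nf : _ = _).trans_lt this
    _ = 2 * Real.exp (-(ζ.re * L)) * Real.sinh (ζ.re * L) * (Complex.normSq (ζ + α) *
      (1 - ‖reflection ζ α * Complex.exp (-(2 * ζ * δ))‖ ^ 2)) := by rw [hN]; ring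
    _ = _ := by ring

/-- Since `|sin (y L)| ≤ y L` and `x L < sinh (x L)`, the length `L` cancels, and an inequality free
of `L` suffices. -/
lemma abs_sin_mul_lt_sinh_mul {x y L S T : ℝ} (hx : 0 < x) (hy : 0 < y) (hL : 0 < L)
    (hS : 0 ≤ S) (hT : 0 < T) (h : y * S ≤ x * T) :
    |Real.sin (y * L)| * S < Real.sinh (x * L) * T := by
  have h1 : |Real.sin (y * L)| ≤ y * L := by
    have := Real.abs_sin_le_abs (x := y * L)
    rwa [abs_of_pos (mul_pos hy hL)] at this
  have h2 : x * L < Real.sinh (x * L) := Real.self_lt_sinh_iff.2 (mul_pos hx hL)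
  calc _ ≤ y * L * S := mul_le_mul_of_nonneg_right h1 hS
    _ = L * (y * S) := by ring
    _ ≤ L * (x * T) := mul_le_mul_of_nonneg_left h hL.le
    _ = x * L * T := by ring
    _ < _ := mul_lt_mul_of_pos_right h2 hT

/-- The crucial inequality between the oscillatory and the damping terms. It is used with
`x + i y = ζ` and `c = 1 - κ²`, for the wave number `1`. -/
lemma oscillation_le_damping {x y σ c δ : ℝ} (hx : 0 < x) (hy : 0 < y) (hσ : 0 < σ) (hδ : 0 < δ)
    (h1 : y ^ 2 - x ^ 2 = c) (h2 : 2 * x * y = σ) (hc1 : c ≤ 1) (hcσ : c ≤ 0 ∨ c ≤ σ ^ 2) :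
    y * |2 * (y * σ - x) * Real.cos (2 * y * δ)
        + ((1 + σ ^ 2) - (x ^ 2 + y ^ 2)) * Real.sin (2 * y * δ)|
      ≤ x * (2 * (x * σ + y) * Real.cosh (2 * x * δ)
        + (x ^ 2 + y ^ 2 + (1 + σ ^ 2)) * Real.sinh (2 * x * δ)) := by
  have hcos := Real.abs_cos_le_one (2 * y * δ)
  have hsin : |Real.sin (2 * y * δ)| ≤ 2 * y * δ := by
    have := Real.abs_sin_le_abs (x := 2 * y * δ)
    rwa [abs_of_pos (a := 2 * y * δ) (by positivity)] at this
  have hcosh := Real.one_le_cosh (2 * x * δ)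
  have hsinh : 2 * x * δ ≤ Real.sinh (2 * x * δ) := Real.self_le_sinh_iff.2 (by positivity)
  -- After linearising in `δ`, `hA` compares the terms of order `0` and `hB` those of order `1`.
  -- Since `2 x y = σ`, the nontrivial half of `hA` is `σ c ≤ σ`.
  have hA : y * |y * σ - x| ≤ x * (x * σ + y) := by
    rw [← abs_of_pos hy, ← abs_mul, abs_of_pos hy, abs_le]
    constructor
    · nlinarith [mul_pos hx hσ, mul_pos (mul_pos hx hx) hσ, mul_pos (mul_pos hy hy) hσ]
    · have : σ * c ≤ σ := by nlinarith
      nlinarith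
  have hB : y ^ 2 * |(1 + σ ^ 2) - (x ^ 2 + y ^ 2)| ≤ x ^ 2 * (x ^ 2 + y ^ 2 + (1 + σ ^ 2)) := by
    have hsq : (x ^ 2 + y ^ 2) ^ 2 = c ^ 2 + σ ^ 2 := by
      rw [← h1, ← h2]
      ring
    have hpos : 0 < x ^ 2 + y ^ 2 := by positivity
    rw [← abs_of_pos (pow_pos hy 2), ← abs_mul, abs_of_pos (pow_pos hy 2), abs_le]
    have hy2 : y ^ 2 = x ^ 2 + c := by linarith
    rcases hcσ with h0 | h0
    · have hle : y ^ 2 ≤ x ^ 2 := by linarith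
      constructor <;> nlinarith [pow_pos hx 2, pow_pos hy 2]
    -- As `|ζ|⁴ = c² + σ²`, this reads `c (1 - c) ≤ σ² (1 - c)`, which is where `c ≤ σ²` is needed.
    · have key : c * (1 + σ ^ 2) ≤ (x ^ 2 + y ^ 2) ^ 2 := by
        rw [hsq]
        nlinarith
      constructor
      · rcases le_total c 0 with h3 | h3
        · nlinarith [pow_pos hx 2, pow_pos hy 2]
        · have hle : x ^ 2 + y ^ 2 ≤ 1 + σ ^ 2 := by
            refine le_of_sq_le_sq ?_ (by positivity)
            rw [hsq]
            nlinarith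
          nlinarith [pow_pos hx 2, pow_pos hy 2]
      · nlinarith [pow_pos hx 2, pow_pos hy 2]
  have hA' : 0 < x * (x * σ + y) := by positivity
  have hB' : 0 < x * (x ^ 2 + y ^ 2 + (1 + σ ^ 2)) := by positivity
  calc _ ≤ y * (|2 * (y * σ - x)| * |Real.cos (2 * y * δ)|
        + |(1 + σ ^ 2) - (x ^ 2 + y ^ 2)| * |Real.sin (2 * y * δ)|) := by
        rw [← abs_mul, ← abs_mul]
        exact mul_le_mul_of_nonneg_left (abs_add_le _ _) hy.le
    _ ≤ y * (|2 * (y * σ - x)| * 1 + |(1 + σ ^ 2) - (x ^ 2 + y ^ 2)| * (2 * y * δ)) := by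
        gcongr
    _ = 2 * (y * |y * σ - x|) + 2 * δ * (y ^ 2 * |(1 + σ ^ 2) - (x ^ 2 + y ^ 2)|) := by
        rw [abs_mul, abs_two]
        ring
    _ ≤ 2 * (x * (x * σ + y)) + 2 * δ * (x ^ 2 * (x ^ 2 + y ^ 2 + (1 + σ ^ 2))) := by
        gcongr
    _ = 2 * (x * (x * σ + y)) * 1 + x * (x ^ 2 + y ^ 2 + (1 + σ ^ 2)) * (2 * x * δ) := by ring
    _ ≤ 2 * (x * (x * σ + y)) * Real.cosh (2 * x * δ)
        + x * (x ^ 2 + y ^ 2 + (1 + σ ^ 2)) * Real.sinh (2 * x * δ) := by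
        gcongr
    _ = _ := by ring

/-! ### The worst mode -/

/-- The limiting convergence factor of the Fourier number `κ` for the wave number `1`. -/
noncomputable def modeFactor (σ δ L κ : ℝ) : ℝ :=
  limitFactor (schwarzA (maxwellZeta 1 σ κ) (Complex.I + σ) δ L)
    (schwarzB (maxwellZeta 1 σ κ) (Complex.I + σ) δ L)

/-- The supremum of the convergence factors over all real Fourier numbers. -/
noncomputable def worstFactor (σ δ L : ℝ) : ℝ≥0 := (⨆ κ : ℝ, modeFactor σ δ L κ).toNNReal

lemma maxwellT_eq {k σ : ℝ} (hk : 0 < k) (hσ : 0 < σ) (δ L κ : ℝ) (N : ℕ) :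
    maxwellT k (σ * k) (δ / k) (L / k) κ N
      = schwarzToeplitz (schwarzA (maxwellZeta 1 σ (κ / k)) (Complex.I + σ) δ L)
          (schwarzB (maxwellZeta 1 σ (κ / k)) (Complex.I + σ) δ L) (N - 1) := by
  have e : Complex.I * k + ((σ * k : ℝ) : ℂ) = k * (Complex.I + σ) := by
    push_cast
    ring
  rw [maxwellT, maxwellZeta_scale hk hσ, e, schwarzA_scale hk, schwarzB_scale hk]

section mode

variable {σ δ L : ℝ}

lemma schwarzB_mode_ne_zero (hσ : 0 < σ) (hδ : 0 < δ) (hL : 0 < L) (κ : ℝ) :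
    schwarzB (maxwellZeta 1 σ κ) (Complex.I + σ) δ L ≠ 0 := by
  refine schwarzB_ne_zero (maxwellZeta_re_pos one_pos hσ κ) (maxwellZeta_im_pos one_pos hσ κ)
    (by simpa) (by simp) hδ hL fun h => ?_
  rw [maxwellZeta_sq] at h
  have := congrArg Complex.im h
  simp [pow_two] at this
  linarith

lemma continuous_modeFactor (hσ : 0 < σ) (hδ : 0 < δ) (hL : 0 < L) :
    Continuous (modeFactor σ δ L) := by
  have hz := continuous_maxwellZeta one_pos hσ
  have hD : ∀ κ, schwarzD (maxwellZeta 1 σ κ) (Complex.I + σ) δ L ≠ 0 := fun κ =>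
    schwarzD_ne_zero (maxwellZeta_re_pos one_pos hσ κ) (maxwellZeta_im_pos one_pos hσ κ)
      (by simpa) (by simp) hδ hL
  have hDc : Continuous fun κ => schwarzD (maxwellZeta 1 σ κ) (Complex.I + σ) δ L := by
    unfold schwarzD
    fun_prop
  have hA : Continuous fun κ => schwarzA (maxwellZeta 1 σ κ) (Complex.I + σ) δ L := by
    unfold schwarzA
    exact Continuous.div (by fun_prop) hDc hD
  have hB : Continuous fun κ => schwarzB (maxwellZeta 1 σ κ) (Complex.I + σ) δ L := by
    unfold schwarzB
    exact Continuous.div (by fun_prop) hDc hD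
  unfold modeFactor limitFactor
  fun_prop

lemma tendsto_exp_neg_maxwellZeta {r : ℝ} (hσ : 0 < σ) (hr : 0 < r) :
    Tendsto (fun κ : ℝ => Complex.exp (-(maxwellZeta 1 σ κ * r))) (cocompact ℝ) (𝓝 0) := by
  rw [tendsto_zero_iff_norm_tendsto_zero]
  simp only [Complex.norm_exp, Complex.neg_re, Complex.re_mul_ofReal]
  exact Real.tendsto_exp_neg_atTop_nhds_zero.comp
    ((tendsto_maxwellZeta_re hσ).atTop_mul_const hr)

/-- The real part of `ζ` tends to infinity and the reflection coefficient stays bounded, so `E` and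
`G` vanish in the limit, and with them `a` and `b`. -/
lemma tendsto_modeFactor (hσ : 0 < σ) (hδ : 0 < δ) (hL : 0 < L) :
    Tendsto (modeFactor σ δ L) (cocompact ℝ) (𝓝 0) := by
  have hE := tendsto_exp_neg_maxwellZeta hσ hL
  have hQ := tendsto_exp_neg_maxwellZeta hσ (r := 2 * δ) (by positivity)
  have hG : Tendsto (fun κ : ℝ => reflection (maxwellZeta 1 σ κ) (Complex.I + σ)
      * Complex.exp (-(2 * maxwellZeta 1 σ κ * δ))) (cocompact ℝ) (𝓝 0) := by
    refine squeeze_zero_norm (fun κ => ?_) (tendsto_zero_iff_norm_tendsto_zero.1 hQ)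
    have e : 2 * maxwellZeta 1 σ κ * δ = maxwellZeta 1 σ κ * ((2 * δ : ℝ) : ℂ) := by
      push_cast
      ring
    rw [norm_mul, e]
    exact mul_le_of_le_one_left (norm_nonneg _) (norm_reflection_lt_one
      (maxwellZeta_re_pos one_pos hσ κ) (maxwellZeta_im_pos one_pos hσ κ) (by simpa)
      (by simp)).le
  have hne : ∀ κ, maxwellZeta 1 σ κ + (Complex.I + σ) ≠ 0 := fun κ =>
    add_ne_zero_of_re_pos (maxwellZeta_re_pos one_pos hσ κ) (by simpa)
  have hden := ((hG.mul hE).pow 2).const_sub 1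
  have hA := (hE.mul ((hG.pow 2).const_sub 1)).div hden (by simp)
  have hB := (hG.neg.mul ((hE.pow 2).const_sub 1)).div hden (by simp)
  have key := (hA.add hB).norm.max (hA.sub hB).norm
  simp only [zero_mul, neg_zero, zero_div, add_zero, sub_zero, norm_zero, max_self] at key
  refine key.congr fun κ => ?_
  rw [modeFactor, limitFactor, schwarzA_eq (hne κ), schwarzB_eq (hne κ)]
  simp only [Pi.div_apply]

/-- A continuous function that vanishes at infinity and is positive somewhere attains its maximum.
Positivity at `0` follows from `b ≠ 0`, as `2 b` is the difference of `a + b` and `a - b`. -/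
lemma exists_forall_modeFactor_le (hσ : 0 < σ) (hδ : 0 < δ) (hL : 0 < L) :
    ∃ κ₀, ∀ κ, modeFactor σ δ L κ ≤ modeFactor σ δ L κ₀ := by
  have hpos : 0 < modeFactor σ δ L 0 := by
    have hb := schwarzB_mode_ne_zero hσ hδ hL 0
    refine lt_of_le_of_ne (limitFactor_nonneg _ _) fun h => hb ?_
    have h1 := le_max_left ‖schwarzA (maxwellZeta 1 σ 0) (Complex.I + σ) δ L
      + schwarzB (maxwellZeta 1 σ 0) (Complex.I + σ) δ L‖ ‖schwarzA (maxwellZeta 1 σ 0)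
        (Complex.I + σ) δ L - schwarzB (maxwellZeta 1 σ 0) (Complex.I + σ) δ L‖
    have h2 := le_max_right ‖schwarzA (maxwellZeta 1 σ 0) (Complex.I + σ) δ L
      + schwarzB (maxwellZeta 1 σ 0) (Complex.I + σ) δ L‖ ‖schwarzA (maxwellZeta 1 σ 0)
        (Complex.I + σ) δ L - schwarzB (maxwellZeta 1 σ 0) (Complex.I + σ) δ L‖
    change _ ≤ modeFactor σ δ L 0 at h1 h2
    rw [← h, norm_le_zero_iff] at h1 h2
    linear_combination (h1 - h2) / 2
  exact (continuous_modeFactor hσ hδ hL).exists_forall_ge' 0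
    ((tendsto_modeFactor hσ hδ hL).eventually (ge_mem_nhds hpos))

lemma exists_worstFactor_eq (hσ : 0 < σ) (hδ : 0 < δ) (hL : 0 < L) :
    ∃ κ₀, (worstFactor σ δ L : ℝ) = modeFactor σ δ L κ₀ ∧
      ∀ κ, modeFactor σ δ L κ ≤ worstFactor σ δ L := by
  obtain ⟨κ₀, h⟩ := exists_forall_modeFactor_le hσ hδ hL
  have e : (worstFactor σ δ L : ℝ) = modeFactor σ δ L κ₀ := by
    have : ⨆ κ : ℝ, modeFactor σ δ L κ = modeFactor σ δ L κ₀ :=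
      le_antisymm (ciSup_le h) (le_ciSup ⟨_, Set.forall_mem_range.2 h⟩ κ₀)
    rw [worstFactor, this]
    exact Real.coe_toNNReal _ (limitFactor_nonneg _ _)
  exact ⟨κ₀, e, fun κ => e ▸ h κ⟩

lemma worstFactor_lt_one (hσ : 0 < σ) (hδ : 0 < δ) (hL : 0 < L)
    (h : ∀ κ, modeFactor σ δ L κ < 1) : worstFactor σ δ L < 1 := by
  obtain ⟨κ₀, h0, -⟩ := exists_worstFactor_eq hσ hδ hL
  rw [← NNReal.coe_lt_coe, h0]
  exact h κ₀

lemma modeFactor_lt_one {κ : ℝ} (hσ : 0 < σ) (hδ : 0 < δ) (hL : 0 < L)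
    (h : ∀ x y : ℝ, 0 < x → 0 < y → y ^ 2 - x ^ 2 = 1 - κ ^ 2 → 2 * x * y = σ →
      |Real.sin (y * L)| * |2 * (y * σ - x) * Real.cos (2 * y * δ)
          + ((1 + σ ^ 2) - (x ^ 2 + y ^ 2)) * Real.sin (2 * y * δ)|
        < Real.sinh (x * L) * (2 * (x * σ + y) * Real.cosh (2 * x * δ)
          + (x ^ 2 + y ^ 2 + (1 + σ ^ 2)) * Real.sinh (2 * x * δ))) :
    modeFactor σ δ L κ < 1 := by
  have h1 := maxwellZeta_re_sq 1 σ κ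
  have h2 := maxwellZeta_re_mul_im 1 σ κ
  have hx := maxwellZeta_re_pos one_pos hσ κ
  have hy := maxwellZeta_im_pos one_pos hσ κ
  refine limitFactor_schwarz_lt_one hx hy (by simpa) (by simp) hδ hL ?_
  have := h _ _ hx hy (by linarith) (by linarith)
  have ea : Complex.normSq (Complex.I + σ) = 1 + σ ^ 2 := by
    simp [Complex.normSq_apply]
    ring
  have ez : Complex.normSq (maxwellZeta 1 σ κ)
      = (maxwellZeta 1 σ κ).re ^ 2 + (maxwellZeta 1 σ κ).im ^ 2 := by
    rw [Complex.normSq_apply]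
    ring
  rw [ea, ez]
  simpa using this

lemma modeFactor_lt_one_of_le {κ : ℝ} (hσ : 0 < σ) (hδ : 0 < δ) (hL : 0 < L)
    (h : 1 ≤ κ ^ 2 ∨ 1 ≤ σ) : modeFactor σ δ L κ < 1 := by
  refine modeFactor_lt_one hσ hδ hL fun x y hx hy h1 h2 => ?_
  have hs : 0 < Real.sinh (2 * x * δ) := Real.sinh_pos_iff.2 (by positivity)
  refine abs_sin_mul_lt_sinh_mul hx hy hL (abs_nonneg _) (by positivity) ?_
  refine oscillation_le_damping hx hy hσ hδ h1 h2 (by nlinarith) ?_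
  rcases h with h | h
  · left
    linarith
  · right
    nlinarith [sq_nonneg κ]

end mode

/-- Uniform bounds for the square root `x + i y` of `-c + i σ` with `0 ≤ c ≤ 1`. -/
lemma sqrt_parts_bounds {x y σ c : ℝ} (hx : 0 < x) (hy : 0 < y)
    (h1 : y ^ 2 - x ^ 2 = c) (h2 : 2 * x * y = σ) (hc0 : 0 ≤ c) (hc1 : c ≤ 1) :
    x ≤ y ∧ y ≤ σ / 2 + 1 ∧ σ / (2 * (σ / 2 + 1)) ≤ x := by
  have hxy : x ≤ y := by
    by_contra! h
    nlinarith
  have hy2 : y ^ 2 ≤ σ / 2 + 1 := by nlinarith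
  have hY : 1 ≤ σ / 2 + 1 := by nlinarith
  have hyY : y ≤ σ / 2 + 1 := by
    by_contra! h
    nlinarith
  refine ⟨hxy, hyY, ?_⟩
  rw [div_le_iff₀ (by linarith)]
  nlinarith

/-- Only the modes with `κ² < 1` remain. For these `X ≤ x ≤ y ≤ Y` with constants depending on `σ`
alone, so the oscillatory term is at most `C`, while the damping grows at least linearly in `δ` and
in `L`. -/
lemma exists_forall_modeFactor_lt_one {σ : ℝ} (hσ : 0 < σ) :
    ∃ M : ℝ, ∀ δ L : ℝ, 0 < δ → 0 < L → M ≤ max δ L → ∀ κ, modeFactor σ δ L κ < 1 := by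
  set Y : ℝ := σ / 2 + 1 with hYdef
  set X : ℝ := σ / (2 * Y) with hXdef
  set C : ℝ := 2 * (Y * σ + Y) + (1 + σ ^ 2 + (Y ^ 2 + Y ^ 2)) with hCdef
  have hY : 1 ≤ Y := by linarith
  have hX : 0 < X := by positivity
  have hC : 0 < C := by positivity
  -- The damping term `T` is at least `2 X` and at least `2 X δ`. A large `δ` gives `Y C ≤ X (2 X
  -- δ)`; a large `L` gives `C ≤ Y C ≤ (X L) (2 X)`, because `1 ≤ Y`.
  refine ⟨Y * C / (2 * X ^ 2), fun δ L hδ hL hM κ => ?_⟩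
  by_cases hκ : 1 ≤ κ ^ 2
  · exact modeFactor_lt_one_of_le hσ hδ hL (Or.inl hκ)
  push Not at hκ
  refine modeFactor_lt_one hσ hδ hL fun x y hx hy h1 h2 => ?_
  obtain ⟨hxy, hyY, hXx⟩ := sqrt_parts_bounds hx hy h1 h2 (by linarith) (by nlinarith)
  rw [← hYdef] at hyY hXx
  rw [← hXdef] at hXx
  have hs : 2 * x * δ < Real.sinh (2 * x * δ) := Real.self_lt_sinh_iff.2 (by positivity)
  have hs0 : 0 < Real.sinh (2 * x * δ) := lt_trans (by positivity) hs
  have hS : |2 * (y * σ - x) * Real.cos (2 * y * δ)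
      + ((1 + σ ^ 2) - (x ^ 2 + y ^ 2)) * Real.sin (2 * y * δ)| ≤ C := by
    have b1 : |2 * (y * σ - x)| ≤ 2 * (Y * σ + Y) := by
      rw [abs_le]
      constructor <;> nlinarith
    have b2 : |(1 + σ ^ 2) - (x ^ 2 + y ^ 2)| ≤ 1 + σ ^ 2 + (Y ^ 2 + Y ^ 2) := by
      rw [abs_le]
      constructor <;> nlinarith
    refine (abs_add_le _ _).trans (add_le_add ?_ ?_)
    · rw [abs_mul]
      exact (mul_le_of_le_one_right (abs_nonneg _) (Real.abs_cos_le_one _)).trans b1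
    · rw [abs_mul]
      exact (mul_le_of_le_one_right (abs_nonneg _) (Real.abs_sin_le_one _)).trans b2
  set S := |2 * (y * σ - x) * Real.cos (2 * y * δ)
      + ((1 + σ ^ 2) - (x ^ 2 + y ^ 2)) * Real.sin (2 * y * δ)| with hSdef
  have hT1 : 2 * X ≤ 2 * (x * σ + y) * Real.cosh (2 * x * δ)
      + (x ^ 2 + y ^ 2 + (1 + σ ^ 2)) * Real.sinh (2 * x * δ) := by
    have e1 : 2 * X ≤ 2 * (x * σ + y) := by nlinarith [mul_pos hx hσ]
    have e2 : 2 * (x * σ + y) ≤ 2 * (x * σ + y) * Real.cosh (2 * x * δ) :=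
      le_mul_of_one_le_right (by positivity) (Real.one_le_cosh _)
    have e3 : 0 ≤ (x ^ 2 + y ^ 2 + (1 + σ ^ 2)) * Real.sinh (2 * x * δ) := by positivity
    linarith
  have hT2 : 2 * X * δ ≤ 2 * (x * σ + y) * Real.cosh (2 * x * δ)
      + (x ^ 2 + y ^ 2 + (1 + σ ^ 2)) * Real.sinh (2 * x * δ) := by
    have e1 : 2 * X * δ ≤ 2 * x * δ := by gcongr
    have e2 : Real.sinh (2 * x * δ) ≤ (x ^ 2 + y ^ 2 + (1 + σ ^ 2)) * Real.sinh (2 * x * δ) :=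
      le_mul_of_one_le_left hs0.le (by nlinarith)
    have e3 : 0 ≤ 2 * (x * σ + y) * Real.cosh (2 * x * δ) := by
      have := Real.cosh_pos (2 * x * δ)
      positivity
    linarith
  set T := 2 * (x * σ + y) * Real.cosh (2 * x * δ)
      + (x ^ 2 + y ^ 2 + (1 + σ ^ 2)) * Real.sinh (2 * x * δ) with hTdef
  have hT : 0 < T := by linarith
  have hX2 : 0 < 2 * X ^ 2 := by positivity
  rcases le_max_iff.1 hM with h | h <;> rw [div_le_iff₀ hX2] at h
  · refine abs_sin_mul_lt_sinh_mul hx hy hL (abs_nonneg _) hT ?_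
    calc y * S ≤ Y * C := by gcongr
      _ ≤ δ * (2 * X ^ 2) := h
      _ = X * (2 * X * δ) := by ring
      _ ≤ x * T := by gcongr
  · calc |Real.sin (y * L)| * S ≤ 1 * C := by
          gcongr
          exact Real.abs_sin_le_one _
      _ ≤ Y * C := by gcongr
      _ ≤ L * (2 * X ^ 2) := h
      _ = X * L * (2 * X) := by ring
      _ ≤ x * L * T := by gcongr
      _ < _ := mul_lt_mul_of_pos_right (Real.self_lt_sinh_iff.2 (mul_pos hx hL)) hT

/-! ### Fourier coefficients of solutions of the Maxwell equations -/

section partials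

variable {F : ℝ → ℝ → ℂ}

lemma hasDerivAt_partialX (hF : ContDiff ℝ 1 fun p : ℝ × ℝ => F p.1 p.2) (x y : ℝ) :
    HasDerivAt (fun s => F s y) (partialX F x y) x := by
  refine DifferentiableAt.hasDerivAt ?_
  have h : Differentiable ℝ fun p : ℝ × ℝ => F p.1 p.2 := hF.differentiable one_ne_zero
  exact (h (x, y)).comp x (f := fun s : ℝ => (s, y)) (by fun_prop)

lemma hasDerivAt_partialY (hF : ContDiff ℝ 1 fun p : ℝ × ℝ => F p.1 p.2) (x y : ℝ) :
    HasDerivAt (fun t => F x t) (partialY F x y) y := by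
  refine DifferentiableAt.hasDerivAt ?_
  have h : Differentiable ℝ fun p : ℝ × ℝ => F p.1 p.2 := hF.differentiable one_ne_zero
  exact (h (x, y)).comp y (f := fun t : ℝ => (x, t)) (by fun_prop)

lemma contDiff_partialX {m n : WithTop ℕ∞} (hF : ContDiff ℝ n fun p : ℝ × ℝ => F p.1 p.2)
    (hmn : m + 1 ≤ n) : ContDiff ℝ m fun p : ℝ × ℝ => partialX F p.1 p.2 := by
  have h : Differentiable ℝ fun p : ℝ × ℝ => F p.1 p.2 :=
    hF.differentiable (by rintro rfl; simp at hmn)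
  have e : (fun p : ℝ × ℝ => partialX F p.1 p.2)
      = fun p => fderiv ℝ (fun p : ℝ × ℝ => F p.1 p.2) p (1, 0) := by
    ext p
    refine HasDerivAt.deriv ?_
    exact (h p).hasFDerivAt.comp_hasDerivAt p.1 (f := fun s : ℝ => (s, p.2))
      ((hasDerivAt_id p.1).prodMk (hasDerivAt_const _ _))
  rw [e]
  exact (hF.fderiv_right hmn).clm_apply contDiff_const

lemma contDiff_partialY {m n : WithTop ℕ∞} (hF : ContDiff ℝ n fun p : ℝ × ℝ => F p.1 p.2)
    (hmn : m + 1 ≤ n) : ContDiff ℝ m fun p : ℝ × ℝ => partialY F p.1 p.2 := by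
  have h : Differentiable ℝ fun p : ℝ × ℝ => F p.1 p.2 :=
    hF.differentiable (by rintro rfl; simp at hmn)
  have e : (fun p : ℝ × ℝ => partialY F p.1 p.2)
      = fun p => fderiv ℝ (fun p : ℝ × ℝ => F p.1 p.2) p (0, 1) := by
    ext p
    refine HasDerivAt.deriv ?_
    exact (h p).hasFDerivAt.comp_hasDerivAt p.2 (f := fun s : ℝ => (p.1, s))
      ((hasDerivAt_const _ _).prodMk (hasDerivAt_id p.2))
  rw [e]
  exact (hF.fderiv_right hmn).clm_apply contDiff_const

lemma continuous_section (hF : Continuous fun p : ℝ × ℝ => F p.1 p.2) (x : ℝ) :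
    Continuous fun y => F x y :=
  hF.comp (f := fun y : ℝ => (x, y)) (by fun_prop)

lemma continuous_integral_mul {g : ℝ → ℂ} (hF : Continuous fun p : ℝ × ℝ => F p.1 p.2)
    (hg : Continuous g) (H : ℝ) : Continuous fun x => ∫ y in (0 : ℝ)..H, F x y * g y :=
  intervalIntegral.continuous_parametric_intervalIntegral_of_continuous'
    (f := fun x y => F x y * g y) (hF.mul (hg.comp continuous_snd)) 0 H

/-- Differentiation under the integral sign. -/
lemma hasDerivAt_integral_mul {g : ℝ → ℂ} (hF : ContDiff ℝ 1 fun p : ℝ × ℝ => F p.1 p.2)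
    (hg : Continuous g) (H x : ℝ) :
    HasDerivAt (fun x => ∫ y in (0 : ℝ)..H, F x y * g y)
      (∫ y in (0 : ℝ)..H, partialX F x y * g y) x := by
  have hF' : Continuous fun p : ℝ × ℝ => partialX F p.1 p.2 :=
    (contDiff_partialX (m := 0) hF (by simp)).continuous
  have hc : Continuous fun p : ℝ × ℝ => partialX F p.1 p.2 * g p.2 :=
    hF'.mul (hg.comp continuous_snd)
  obtain ⟨C, hC⟩ := ((isCompact_closedBall x 1).prod (isCompact_uIcc (a := 0) (b := H))
    ).exists_bound_of_continuousOn hc.continuousOn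
  refine (intervalIntegral.hasDerivAt_integral_of_dominated_loc_of_deriv_le
    (F := fun x y => F x y * g y) (F' := fun x y => partialX F x y * g y) (bound := fun _ => C)
    (Metric.closedBall_mem_nhds x one_pos) (Eventually.of_forall fun s => ?_) ?_ ?_ ?_ ?_ ?_).2
  · exact ((continuous_section hF.continuous s).mul hg).aestronglyMeasurable
  · exact ((continuous_section hF.continuous x).mul hg).intervalIntegrable _ _
  · exact ((continuous_section hF' x).mul hg).aestronglyMeasurable
  · exact Eventually.of_forall fun t ht s hs => hC (s, t) ⟨hs, Set.uIoc_subset_uIcc ht⟩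
  · exact intervalIntegrable_const
  · exact Eventually.of_forall fun t _ s _ => (hasDerivAt_partialX hF s t).mul_const _

end partials

/-- Sine coefficient (up to the factor `2 / Lhat`) of a function on `(0, Lhat)`. -/
noncomputable def sinCoeff (Lhat κ : ℝ) (f : ℝ → ℂ) : ℂ :=
  ∫ y in (0 : ℝ)..Lhat, f y * (Real.sin (κ * y) : ℂ)

lemma hasDerivAt_ofReal_sin_mul (κ y : ℝ) :
    HasDerivAt (fun y : ℝ => (Real.sin (κ * y) : ℂ)) (κ * (Real.cos (κ * y) : ℂ)) y := by
  have := ((Real.hasDerivAt_sin (κ * y)).comp y ((hasDerivAt_id y).const_mul κ)).ofReal_comp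
  simpa [mul_comm] using this

lemma hasDerivAt_ofReal_cos_mul (κ y : ℝ) :
    HasDerivAt (fun y : ℝ => (Real.cos (κ * y) : ℂ)) (-(κ * (Real.sin (κ * y) : ℂ))) y := by
  have := ((Real.hasDerivAt_cos (κ * y)).comp y ((hasDerivAt_id y).const_mul κ)).ofReal_comp
  simpa [mul_comm] using this

/-- Integration by parts: the sine vanishes at both ends, so `f` needs no boundary condition. For
the cosine coefficient of a derivative, `f` itself has to vanish there, which is what the perfect
conductor provides for `E_x`. -/
lemma sinCoeff_deriv {H κ : ℝ} {f f' : ℝ → ℂ} (hf : ∀ y, HasDerivAt f (f' y) y)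
    (hf' : Continuous f') (hκ : Real.sin (κ * H) = 0) :
    sinCoeff H κ f' = -κ * cosCoeff H κ f := by
  have h := intervalIntegral.integral_deriv_mul_eq_sub (a := 0) (b := H)
    (fun y _ => hf y) (fun y _ => hasDerivAt_ofReal_sin_mul κ y)
    (hf'.intervalIntegrable _ _)
    (Continuous.intervalIntegrable (by fun_prop) _ _)
  have hfc : Continuous f := continuous_iff_continuousAt.2 fun y => (hf y).continuousAt
  rw [intervalIntegral.integral_add (Continuous.intervalIntegrable (by fun_prop) _ _)
    (Continuous.intervalIntegrable (by fun_prop) _ _)] at h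
  have e : ∫ y in (0 : ℝ)..H, f y * (κ * (Real.cos (κ * y) : ℂ)) = κ * cosCoeff H κ f := by
    rw [cosCoeff, ← intervalIntegral.integral_const_mul]
    congr 1
    ext y
    ring
  rw [e, hκ] at h
  simp only [mul_zero, Real.sin_zero, Complex.ofReal_zero, sub_zero] at h
  rw [sinCoeff]
  linear_combination h

lemma cosCoeff_deriv {H κ : ℝ} {f f' : ℝ → ℂ} (hf : ∀ y, HasDerivAt f (f' y) y)
    (hf' : Continuous f') (h0 : f 0 = 0) (hH : f H = 0) :
    cosCoeff H κ f' = κ * sinCoeff H κ f := by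
  have h := intervalIntegral.integral_deriv_mul_eq_sub (a := 0) (b := H)
    (fun y _ => hf y) (fun y _ => hasDerivAt_ofReal_cos_mul κ y)
    (hf'.intervalIntegrable _ _)
    (Continuous.intervalIntegrable (by fun_prop) _ _)
  have hfc : Continuous f := continuous_iff_continuousAt.2 fun y => (hf y).continuousAt
  rw [intervalIntegral.integral_add (Continuous.intervalIntegrable (by fun_prop) _ _)
    (Continuous.intervalIntegrable (by fun_prop) _ _)] at h
  have e : ∫ y in (0 : ℝ)..H, f y * -(κ * (Real.sin (κ * y) : ℂ)) = -κ * sinCoeff H κ f := by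
    rw [sinCoeff, ← intervalIntegral.integral_const_mul]
    congr 1
    ext y
    ring
  rw [e, h0, hH] at h
  simp only [zero_mul, sub_zero] at h
  rw [cosCoeff]
  linear_combination h

lemma cosCoeff_add {H κ : ℝ} {f g : ℝ → ℂ} (hf : Continuous f) (hg : Continuous g) :
    cosCoeff H κ (fun y => f y + g y) = cosCoeff H κ f + cosCoeff H κ g := by
  simp only [cosCoeff, add_mul]
  exact intervalIntegral.integral_add (Continuous.intervalIntegrable (by fun_prop) _ _)
    (Continuous.intervalIntegrable (by fun_prop) _ _)

lemma sinCoeff_add {H κ : ℝ} {f g : ℝ → ℂ} (hf : Continuous f) (hg : Continuous g) :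
    sinCoeff H κ (fun y => f y + g y) = sinCoeff H κ f + sinCoeff H κ g := by
  simp only [sinCoeff, add_mul]
  exact intervalIntegral.integral_add (Continuous.intervalIntegrable (by fun_prop) _ _)
    (Continuous.intervalIntegrable (by fun_prop) _ _)

lemma cosCoeff_const_mul (H κ : ℝ) (c : ℂ) (f : ℝ → ℂ) :
    cosCoeff H κ (fun y => c * f y) = c * cosCoeff H κ f := by
  simp only [cosCoeff, mul_assoc]
  exact intervalIntegral.integral_const_mul _ _

lemma sinCoeff_const_mul (H κ : ℝ) (c : ℂ) (f : ℝ → ℂ) :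
    sinCoeff H κ (fun y => c * f y) = c * sinCoeff H κ f := by
  simp only [sinCoeff, mul_assoc]
  exact intervalIntegral.integral_const_mul _ _

lemma cosCoeff_congr {H κ : ℝ} (hH : 0 ≤ H) {f g : ℝ → ℂ} (h : ∀ y ∈ Set.Ioo 0 H, f y = g y) :
    cosCoeff H κ f = cosCoeff H κ g :=
  intervalIntegral.integral_congr_Ioo_of_le hH fun y hy => by simp only [h y hy]

lemma sinCoeff_congr {H κ : ℝ} (hH : 0 ≤ H) {f g : ℝ → ℂ} (h : ∀ y ∈ Set.Ioo 0 H, f y = g y) :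
    sinCoeff H κ f = sinCoeff H κ g :=
  intervalIntegral.integral_congr_Ioo_of_le hH fun y hy => by simp only [h y hy]

lemma cosCoeff_zero (H κ : ℝ) : cosCoeff H κ (fun _ => 0) = 0 := by simp [cosCoeff]

lemma sinCoeff_zero (H κ : ℝ) : sinCoeff H κ (fun _ => 0) = 0 := by simp [sinCoeff]

section mode

variable {k σ H κ p q : ℝ} {Ex Ey : ℝ → ℝ → ℂ}

lemma hasDerivAt_sinCoeff {F : ℝ → ℝ → ℂ} (hF : ContDiff ℝ 1 fun p : ℝ × ℝ => F p.1 p.2)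
    (H κ x : ℝ) : HasDerivAt (fun x => sinCoeff H κ (F x)) (sinCoeff H κ (partialX F x)) x :=
  hasDerivAt_integral_mul hF (g := fun y => (Real.sin (κ * y) : ℂ)) (by fun_prop) H x

lemma hasDerivAt_cosCoeff {F : ℝ → ℝ → ℂ} (hF : ContDiff ℝ 1 fun p : ℝ × ℝ => F p.1 p.2)
    (H κ x : ℝ) : HasDerivAt (fun x => cosCoeff H κ (F x)) (cosCoeff H κ (partialX F x)) x :=
  hasDerivAt_integral_mul hF (g := fun y => (Real.cos (κ * y) : ℂ)) (by fun_prop) H x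

lemma continuous_cosCoeff {F : ℝ → ℝ → ℂ} (hF : Continuous fun p : ℝ × ℝ => F p.1 p.2)
    (H κ : ℝ) : Continuous fun x => cosCoeff H κ (F x) :=
  continuous_integral_mul hF (g := fun y => (Real.cos (κ * y) : ℂ)) (by fun_prop) H

/-- The first Maxwell equation for a Fourier mode. -/
lemma maxwell_mode_x (hH : 0 ≤ H) (hκ : Real.sin (κ * H) = 0)
    (hEx : ContDiff ℝ 2 fun p : ℝ × ℝ => Ex p.1 p.2)
    (hEy : ContDiff ℝ 2 fun p : ℝ × ℝ => Ey p.1 p.2) {x : ℝ}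
    (hx : ∀ y ∈ Set.Ioo 0 H, -(k : ℂ) ^ 2 * Ex x y - partialY (partialY Ex) x y
        + partialX (partialY Ey) x y + Complex.I * k * σ * Ex x y = 0)
    (h0 : Ex x 0 = 0) (h1 : Ex x H = 0) :
    (Complex.I * k * σ + κ ^ 2 - k ^ 2) * sinCoeff H κ (Ex x)
      = κ * cosCoeff H κ (partialX Ey x) := by
  have hEx1 := hEx.of_le one_le_two
  have hEy1 := hEy.of_le one_le_two
  have hYx := contDiff_partialY (m := 1) hEx (by norm_num)
  have hYy := contDiff_partialY (m := 1) hEy (by norm_num)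
  have cYYx := (contDiff_partialY (m := 0) hYx (by norm_num)).continuous
  have cXYy := (contDiff_partialX (m := 0) hYy (by norm_num)).continuous
  have c1 := continuous_section hEx.continuous x
  have c2 := continuous_section cYYx x
  have c3 := continuous_section cXYy x
  have i1 : sinCoeff H κ (partialY (partialY Ex) x) = -κ ^ 2 * sinCoeff H κ (Ex x) := by
    rw [sinCoeff_deriv (fun y => hasDerivAt_partialY hYx x y) c2 hκ,
      cosCoeff_deriv (fun y => hasDerivAt_partialY hEx1 x y) (continuous_section hYx.continuous x)
        h0 h1]
    ring
  have i2 : sinCoeff H κ (partialX (partialY Ey) x) = -κ * cosCoeff H κ (partialX Ey x) := by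
    -- Integrating by parts in `y` before differentiating in `x` avoids exchanging the mixed
    -- derivatives.
    have e : (fun x => sinCoeff H κ (partialY Ey x)) = fun x => -κ * cosCoeff H κ (Ey x) := by
      ext x
      exact sinCoeff_deriv (fun y => hasDerivAt_partialY hEy1 x y)
        (continuous_section hYy.continuous x) hκ
    have d1 := hasDerivAt_sinCoeff hYy H κ x
    rw [e] at d1
    exact d1.unique ((hasDerivAt_cosCoeff hEy1 H κ x).const_mul _)
  have key := sinCoeff_congr (κ := κ) hH
    (f := fun y => (Complex.I * k * σ - k ^ 2) * Ex x y + ((-1) * partialY (partialY Ex) x y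
      + partialX (partialY Ey) x y)) (g := fun _ => 0)
    (fun y hy => by rw [← hx y hy]; ring)
  rw [sinCoeff_zero, sinCoeff_add (by fun_prop) (by fun_prop),
    sinCoeff_add (by fun_prop) (by fun_prop), sinCoeff_const_mul, sinCoeff_const_mul] at key
  change _ * sinCoeff H κ (Ex x) + (-1 * sinCoeff H κ (partialY (partialY Ex) x)
    + sinCoeff H κ (partialX (partialY Ey) x)) = 0 at key
  rw [i1, i2] at key
  linear_combination key

/-- The second Maxwell equation for a Fourier mode. -/
lemma maxwell_mode_y (hH : 0 ≤ H)
    (hEx : ContDiff ℝ 2 fun p : ℝ × ℝ => Ex p.1 p.2)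
    (hEy : ContDiff ℝ 2 fun p : ℝ × ℝ => Ey p.1 p.2) {x : ℝ} (hxI : x ∈ Set.Ioo p q)
    (hx : ∀ y ∈ Set.Ioo 0 H, -(k : ℂ) ^ 2 * Ey x y - partialX (partialX Ey) x y
        + partialX (partialY Ex) x y + Complex.I * k * σ * Ey x y = 0)
    (hpec : ∀ x ∈ Set.Ioo p q, Ex x 0 = 0 ∧ Ex x H = 0) :
    (Complex.I * k * σ - k ^ 2) * cosCoeff H κ (Ey x) + κ * sinCoeff H κ (partialX Ex x)
      = cosCoeff H κ (partialX (partialX Ey) x) := by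
  have hEx1 := hEx.of_le one_le_two
  have hEy1 := hEy.of_le one_le_two
  have hYx := contDiff_partialY (m := 1) hEx (by norm_num)
  have hXy := contDiff_partialX (m := 1) hEy (by norm_num)
  have cXYx := (contDiff_partialX (m := 0) hYx (by norm_num)).continuous
  have cXXy := (contDiff_partialX (m := 0) hXy (by norm_num)).continuous
  have c1 := continuous_section hEy.continuous x
  have c2 := continuous_section cXYx x
  have c3 := continuous_section cXXy x
  have i1 : cosCoeff H κ (partialX (partialY Ex) x) = κ * sinCoeff H κ (partialX Ex x) := by
    have e : (fun x => cosCoeff H κ (partialY Ex x)) =ᶠ[𝓝 x]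
        fun x => κ * sinCoeff H κ (Ex x) := by
      filter_upwards [Ioo_mem_nhds hxI.1 hxI.2] with s hs
      exact cosCoeff_deriv (fun y => hasDerivAt_partialY hEx1 s y)
        (continuous_section hYx.continuous s) (hpec s hs).1 (hpec s hs).2
    exact (hasDerivAt_cosCoeff hYx H κ x).unique
      (((hasDerivAt_sinCoeff hEx1 H κ x).const_mul _).congr_of_eventuallyEq e)
  have key := cosCoeff_congr (κ := κ) hH
    (f := fun y => (Complex.I * k * σ - k ^ 2) * Ey x y + ((-1) * partialX (partialX Ey) x y
      + partialX (partialY Ex) x y)) (g := fun _ => 0)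
    (fun y hy => by rw [← hx y hy]; ring)
  rw [cosCoeff_zero, cosCoeff_add (by fun_prop) (by fun_prop),
    cosCoeff_add (by fun_prop) (by fun_prop), cosCoeff_const_mul, cosCoeff_const_mul] at key
  change _ * cosCoeff H κ (Ey x) + (-1 * cosCoeff H κ (partialX (partialX Ey) x)
    + cosCoeff H κ (partialX (partialY Ex) x)) = 0 at key
  rw [i1] at key
  linear_combination key

/-- The general solution of the mode system `v' = κ w`, `κ w' = ζ² v`. -/
lemma exists_exp_of_mode_system {ζ : ℂ} {v w : ℝ → ℂ}
    (hv : ∀ x ∈ Set.Ioo p q, HasDerivAt v (κ * w x) x)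
    (hw : ∀ x ∈ Set.Ioo p q, ∃ w', HasDerivAt w w' x ∧ ζ ^ 2 * v x = κ * w') :
    ∃ A B : ℂ, ∀ x ∈ Set.Ioo p q, κ * w x + ζ * v x = A * Complex.exp (ζ * x) ∧
      κ * w x - ζ * v x = B * Complex.exp (-(ζ * x)) := by
  have main : ∀ η : ℂ, η ^ 2 = ζ ^ 2 → ∃ A : ℂ, ∀ x ∈ Set.Ioo p q,
      κ * w x + η * v x = A * Complex.exp (η * x) := by
    intro η hη
    -- For `η = ± ζ`, the combination `κ w + η v` satisfies `f' = η f`, so its product with `exp (-η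
    -- x)` is constant.
    have hd : ∀ x ∈ Set.Ioo p q,
        HasDerivAt (fun x : ℝ => (κ * w x + η * v x) * Complex.exp (-η * x)) 0 x := by
      intro x hx
      obtain ⟨w', h1, h2⟩ := hw x hx
      have he : HasDerivAt (fun x : ℝ => Complex.exp (-η * x)) (Complex.exp (-η * x) * (-η * 1)) x :=
        ((hasDerivAt_id x).ofReal_comp.const_mul (-η)).cexp
      refine (((h1.const_mul _).add ((hv x hx).const_mul η)).mul he).congr_deriv ?_
      simp only [Pi.add_apply]
      linear_combination (-Complex.exp (-η * x)) * h2 - v x * Complex.exp (-η * x) * hη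
    obtain ⟨A, hA⟩ := isOpen_Ioo.exists_is_const_of_deriv_eq_zero (isPreconnected_Ioo (a := p) (b := q))
      (fun x hx => (hd x hx).differentiableAt.differentiableWithinAt)
      (fun x hx => (hd x hx).deriv)
    refine ⟨A, fun x hx => ?_⟩
    rw [← hA x hx, mul_assoc, ← Complex.exp_add]
    simp
  obtain ⟨A, hA⟩ := main ζ rfl
  obtain ⟨B, hB⟩ := main (-ζ) (neg_sq ζ)
  refine ⟨A, B, fun x hx => ⟨hA x hx, ?_⟩⟩
  rw [← neg_mul, ← hB x hx]
  ring

/-- The impedance data of a Fourier mode of a solution of the Maxwell equations. -/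
lemma exists_impedance_eq (hk : k ≠ 0) (hσ : σ ≠ 0) (hH : 0 ≤ H) (hκ0 : κ ≠ 0)
    (hκ : Real.sin (κ * H) = 0) (hpq : p < q) {ζ : ℂ} (hζ0 : ζ ≠ 0)
    (hζ : ζ ^ 2 = Complex.I * k * σ + κ ^ 2 - k ^ 2)
    (hEx : ContDiff ℝ 2 fun p : ℝ × ℝ => Ex p.1 p.2)
    (hEy : ContDiff ℝ 2 fun p : ℝ × ℝ => Ey p.1 p.2)
    (hx : ∀ x ∈ Set.Ioo p q, ∀ y ∈ Set.Ioo 0 H,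
      -(k : ℂ) ^ 2 * Ex x y - partialY (partialY Ex) x y
        + partialX (partialY Ey) x y + Complex.I * k * σ * Ex x y = 0)
    (hy : ∀ x ∈ Set.Ioo p q, ∀ y ∈ Set.Ioo 0 H,
      -(k : ℂ) ^ 2 * Ey x y - partialX (partialX Ey) x y
        + partialX (partialY Ex) x y + Complex.I * k * σ * Ey x y = 0)
    (hpec : ∀ x ∈ Set.Ioo p q, Ex x 0 = 0 ∧ Ex x H = 0) :
    ∃ A B : ℂ, ∀ x ∈ Set.Icc p q,
      cosCoeff H κ (impedanceR k Ex Ey x)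
        = (ζ + (Complex.I * k + σ)) * A * Complex.exp (ζ * x)
          + (ζ - (Complex.I * k + σ)) * B * Complex.exp (-(ζ * x)) ∧
      cosCoeff H κ (impedanceL k Ex Ey x)
        = (ζ - (Complex.I * k + σ)) * A * Complex.exp (ζ * x)
          + (ζ + (Complex.I * k + σ)) * B * Complex.exp (-(ζ * x)) := by
  have hκc : (κ : ℂ) ≠ 0 := by exact_mod_cast hκ0
  have hEx1 := hEx.of_le one_le_two
  have hEy1 := hEy.of_le one_le_two
  have hYx := contDiff_partialY (m := 1) hEx (by norm_num)
  have hXy := contDiff_partialX (m := 1) hEy (by norm_num)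
  have hne : Complex.I * k * σ - (k : ℂ) ^ 2 ≠ 0 := by
    intro h
    have := congrArg Complex.im h
    simp [pow_two, hk, hσ] at this
  have mx : ∀ x ∈ Set.Ioo p q, ζ ^ 2 * sinCoeff H κ (Ex x) = κ * cosCoeff H κ (partialX Ey x) := by
    intro x hxI
    rw [hζ]
    exact maxwell_mode_x hH hκ hEx hEy (hx x hxI) (hpec x hxI).1 (hpec x hxI).2
  -- This is the divergence constraint: differentiating the first mode equation and eliminating the
  -- second derivative of `E_y` leaves `v' = κ w` multiplied by `i k σ - k²`, which is nonzero.
  have dv : ∀ x ∈ Set.Ioo p q,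
      HasDerivAt (fun x => sinCoeff H κ (Ex x)) (κ * cosCoeff H κ (Ey x)) x := by
    intro x hxI
    refine (hasDerivAt_sinCoeff hEx1 H κ x).congr_deriv ?_
    have my := maxwell_mode_y (κ := κ) hH hEx hEy hxI (hy x hxI) hpec
    have e : (fun x => ζ ^ 2 * sinCoeff H κ (Ex x)) =ᶠ[𝓝 x]
        fun x => κ * cosCoeff H κ (partialX Ey x) := by
      filter_upwards [Ioo_mem_nhds hxI.1 hxI.2] with s hs using mx s hs
    have d := ((hasDerivAt_sinCoeff hEx1 H κ x).const_mul (ζ ^ 2)).unique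
      (((hasDerivAt_cosCoeff hXy H κ x).const_mul (κ : ℂ)).congr_of_eventuallyEq e)
    rw [hζ] at d
    refine mul_left_cancel₀ hne ?_
    linear_combination d - κ * my
  obtain ⟨A, B, hAB⟩ := exists_exp_of_mode_system (ζ := ζ) dv
    (fun x hxI => ⟨_, hasDerivAt_cosCoeff hEy1 H κ x, mx x hxI⟩)
  have hc : ∀ x, Continuous (partialX Ey x) ∧ Continuous (Ey x) ∧ Continuous (partialY Ex x) :=
    fun x => ⟨continuous_section hXy.continuous x, continuous_section hEy.continuous x,
      continuous_section hYx.continuous x⟩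
  have eR : ∀ x, cosCoeff H κ (impedanceR k Ex Ey x) = cosCoeff H κ (partialX Ey x)
      + (Complex.I * k * cosCoeff H κ (Ey x) + -1 * cosCoeff H κ (partialY Ex x)) := by
    intro x
    obtain ⟨h1, h2, h3⟩ := hc x
    rw [← cosCoeff_const_mul, ← cosCoeff_const_mul, ← cosCoeff_add (by fun_prop) (by fun_prop),
      ← cosCoeff_add (by fun_prop) (by fun_prop)]
    congr 1
    ext y
    rw [impedanceR]
    ring
  have eL : ∀ x, cosCoeff H κ (impedanceL k Ex Ey x) = -1 * cosCoeff H κ (partialX Ey x)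
      + (Complex.I * k * cosCoeff H κ (Ey x) + cosCoeff H κ (partialY Ex x)) := by
    intro x
    obtain ⟨h1, h2, h3⟩ := hc x
    rw [← cosCoeff_const_mul, ← cosCoeff_const_mul, ← cosCoeff_add (by fun_prop) (by fun_prop),
      ← cosCoeff_add (by fun_prop) (by fun_prop)]
    congr 1
    ext y
    rw [impedanceL]
    ring
  have cX := continuous_cosCoeff hXy.continuous H κ
  have cE := continuous_cosCoeff hEy.continuous H κ
  have cY := continuous_cosCoeff hYx.continuous H κ
  have hpecY : ∀ x ∈ Set.Ioo p q, cosCoeff H κ (partialY Ex x) = κ * sinCoeff H κ (Ex x) :=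
    fun x hxI => cosCoeff_deriv (fun y => hasDerivAt_partialY hEx1 x y)
      (continuous_section hYx.continuous x) (hpec x hxI).1 (hpec x hxI).2
  have hI2 := Complex.I_sq
  have hX : ∀ x ∈ Set.Ioo p q, cosCoeff H κ (partialX Ey x) = ζ ^ 2 * sinCoeff H κ (Ex x) / κ :=
    fun x hxI => by rw [mx x hxI]; field_simp
  have hE : ∀ x ∈ Set.Ioo p q, cosCoeff H κ (Ey x)
      = (A * Complex.exp (ζ * x) + B * Complex.exp (-(ζ * x))) / (2 * κ) := by
    intro x hxI
    rw [← (hAB x hxI).1, ← (hAB x hxI).2]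
    field_simp
    ring
  have hS : ∀ x ∈ Set.Ioo p q, sinCoeff H κ (Ex x)
      = (A * Complex.exp (ζ * x) - B * Complex.exp (-(ζ * x))) / (2 * ζ) := by
    intro x hxI
    rw [← (hAB x hxI).1, ← (hAB x hxI).2]
    field_simp
    ring
  -- The right and left data are `(i k / κ) (v' + α v)` and `(i k / κ) (v' - α v)`; the remaining `1
  -- / (2 ζ)` comes from writing `v` in terms of `A` and `B`.
  let c : ℂ := Complex.I * k / (2 * κ * ζ)
  refine ⟨c * A, c * B, ?_⟩
  -- The equations hold only inside the interval; continuity carries the formulas to its ends, where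
  -- data are exchanged.
  rw [← closure_Ioo hpq.ne]
  have clR : Set.EqOn (fun x : ℝ => cosCoeff H κ (impedanceR k Ex Ey x))
      (fun x : ℝ => (ζ + (Complex.I * k + σ)) * (c * A) * Complex.exp (ζ * x)
          + (ζ - (Complex.I * k + σ)) * (c * B) * Complex.exp (-(ζ * x))) (Set.Ioo p q) := by
    intro x hxI
    simp only [c]
    rw [eR x, hpecY x hxI, hX x hxI, hE x hxI, hS x hxI, hζ]
    field_simp
    linear_combination (-(A * Complex.exp (ζ * x) - B * Complex.exp (-(ζ * x))) * k ^ 2) * hI2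
  have clL : Set.EqOn (fun x : ℝ => cosCoeff H κ (impedanceL k Ex Ey x))
      (fun x : ℝ => (ζ - (Complex.I * k + σ)) * (c * A) * Complex.exp (ζ * x)
          + (ζ + (Complex.I * k + σ)) * (c * B) * Complex.exp (-(ζ * x))) (Set.Ioo p q) := by
    intro x hxI
    simp only [c]
    rw [eL x, hpecY x hxI, hX x hxI, hE x hxI, hS x hxI, hζ]
    field_simp
    linear_combination ((A * Complex.exp (ζ * x) - B * Complex.exp (-(ζ * x))) * k ^ 2) * hI2
  have clR' := clR.closure (by simp only [eR]; fun_prop) (by fun_prop)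
  have clL' := clL.closure (by simp only [eL]; fun_prop) (by fun_prop)
  exact fun x hxI => ⟨clR' hxI, clL' hxI⟩

end mode

/-! ### The Schwarz iteration -/

/-- `schwarzD` is, up to sign, the determinant of the system for `A` and `B` given the incoming data
at the two ends `p` and `p + L + 2 δ`. Solving it and evaluating where the neighbours' boundaries
lie, at `p + 2 δ` and `p + L`, gives the coefficients. -/
lemma schwarz_transfer {ζ α A B : ℂ} {p δ L : ℝ} (hD : schwarzD ζ α δ L ≠ 0) (R I : ℝ → ℂ)
    (hR : ∀ x : ℝ, R x = (ζ + α) * A * Complex.exp (ζ * x) + (ζ - α) * B * Complex.exp (-(ζ * x)))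
    (hI : ∀ x : ℝ, I x = (ζ - α) * A * Complex.exp (ζ * x) + (ζ + α) * B * Complex.exp (-(ζ * x))) :
    R (p + 2 * δ) = schwarzB ζ α δ L * -I p + schwarzA ζ α δ L * R (p + L + 2 * δ) ∧
      -I (p + L) = schwarzB ζ α δ L * R (p + L + 2 * δ) + schwarzA ζ α δ L * -I p := by
  have e1 : Complex.exp (ζ * (2 * δ + L)) = Complex.exp (2 * ζ * δ) * Complex.exp (ζ * L) := by
    rw [← Complex.exp_add]; congr 1; ring
  have e2 : Complex.exp (-ζ * (2 * δ + L))
      = (Complex.exp (2 * ζ * δ))⁻¹ * (Complex.exp (ζ * L))⁻¹ := by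
    rw [← Complex.exp_neg, ← Complex.exp_neg, ← Complex.exp_add]; congr 1; ring
  have e3 : Complex.exp (-(2 * ζ * δ)) = (Complex.exp (2 * ζ * δ))⁻¹ := Complex.exp_neg _
  have e4 : Complex.exp (-ζ * L) = (Complex.exp (ζ * L))⁻¹ := by
    rw [← Complex.exp_neg, neg_mul]
  have f1 : Complex.exp (ζ * (p + 2 * δ : ℝ)) = Complex.exp (ζ * p) * Complex.exp (2 * ζ * δ) := by
    rw [← Complex.exp_add]; congr 1; push_cast; ring
  have f2 : Complex.exp (ζ * (p + L : ℝ)) = Complex.exp (ζ * p) * Complex.exp (ζ * L) := by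
    rw [← Complex.exp_add]; congr 1; push_cast; ring
  have f3 : Complex.exp (ζ * (p + L + 2 * δ : ℝ))
      = Complex.exp (ζ * p) * Complex.exp (2 * ζ * δ) * Complex.exp (ζ * L) := by
    rw [← Complex.exp_add, ← Complex.exp_add]; congr 1; push_cast; ring
  have n1 := Complex.exp_ne_zero (2 * ζ * δ)
  have n2 := Complex.exp_ne_zero (ζ * L)
  have n3 := Complex.exp_ne_zero (ζ * p)
  simp only [hR, hI, schwarzA, schwarzB, Complex.exp_neg (ζ * _), f1, f2, f3]
  rw [schwarzD, e1, e2] at hD ⊢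
  rw [e3, e4]
  generalize Complex.exp (2 * ζ * δ) = d at *
  generalize Complex.exp (ζ * L) = l at *
  generalize Complex.exp (ζ * p) = e at *
  constructor
  · rw [div_mul_eq_mul_div, div_mul_eq_mul_div, ← add_div, eq_div_iff hD]
    field_simp
    ring
  · rw [div_mul_eq_mul_div, div_mul_eq_mul_div, ← add_div, eq_div_iff hD]
    field_simp
    ring

lemma sin_fourierNumber_mul {H : ℝ} (hH : 0 < H) (m : ℕ) :
    Real.sin (fourierNumber H m * H) = 0 := by
  have : fourierNumber H m * H = m * Real.pi := by
    rw [fourierNumber]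
    field_simp
  rw [this, Real.sin_nat_mul_pi]

lemma fourierNumber_ne_zero {H : ℝ} (hH : 0 < H) {m : ℕ} (hm : 1 ≤ m) : fourierNumber H m ≠ 0 := by
  have : (0 : ℝ) < m := by exact_mod_cast hm
  rw [fourierNumber]
  positivity

/-- The impedance data which a subdomain hands on, in terms of those which it receives. -/
lemma maxwell_subdomain {k σ δ L H κ p : ℝ} {Ex Ey : ℝ → ℝ → ℂ} (hk : 0 < k) (hσ : 0 < σ)
    (hδ : 0 < δ) (hL : 0 < L) (hH : 0 ≤ H) (hκ0 : κ ≠ 0) (hκ : Real.sin (κ * H) = 0)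
    (hEx : ContDiff ℝ 2 fun p : ℝ × ℝ => Ex p.1 p.2)
    (hEy : ContDiff ℝ 2 fun p : ℝ × ℝ => Ey p.1 p.2)
    (hx : ∀ x ∈ Set.Ioo p (p + L + 2 * δ), ∀ y ∈ Set.Ioo 0 H,
      -(k : ℂ) ^ 2 * Ex x y - partialY (partialY Ex) x y
        + partialX (partialY Ey) x y + Complex.I * k * σ * Ex x y = 0)
    (hy : ∀ x ∈ Set.Ioo p (p + L + 2 * δ), ∀ y ∈ Set.Ioo 0 H,
      -(k : ℂ) ^ 2 * Ey x y - partialX (partialX Ey) x y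
        + partialX (partialY Ex) x y + Complex.I * k * σ * Ey x y = 0)
    (hpec : ∀ x ∈ Set.Ioo p (p + L + 2 * δ), Ex x 0 = 0 ∧ Ex x H = 0) :
    cosCoeff H κ (impedanceR k Ex Ey (p + 2 * δ))
        = schwarzB (maxwellZeta k σ κ) (Complex.I * k + σ) δ L *
            -cosCoeff H κ (impedanceL k Ex Ey p)
          + schwarzA (maxwellZeta k σ κ) (Complex.I * k + σ) δ L *
            cosCoeff H κ (impedanceR k Ex Ey (p + L + 2 * δ)) ∧
      -cosCoeff H κ (impedanceL k Ex Ey (p + L))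
        = schwarzB (maxwellZeta k σ κ) (Complex.I * k + σ) δ L *
            cosCoeff H κ (impedanceR k Ex Ey (p + L + 2 * δ))
          + schwarzA (maxwellZeta k σ κ) (Complex.I * k + σ) δ L *
            -cosCoeff H κ (impedanceL k Ex Ey p) := by
  have hre := maxwellZeta_re_pos hk hσ κ
  have him := maxwellZeta_im_pos hk hσ κ
  have hζ0 : maxwellZeta k σ κ ≠ 0 := fun h => by simp [h] at hre
  obtain ⟨A, B, hAB⟩ := exists_impedance_eq hk.ne' hσ.ne' hH hκ0 hκ
    (by linarith : p < p + L + 2 * δ) hζ0 (maxwellZeta_sq k σ κ) hEx hEy hx hy hpec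
  have hD := schwarzD_ne_zero (α := Complex.I * k + σ) hre him (by simpa) (by simpa) hδ hL
  have T := schwarz_transfer (p := p) (A := A) (B := B) hD _ _ (fun _ => rfl) (fun _ => rfl)
  rw [(hAB (p + 2 * δ) ⟨by linarith, by linarith⟩).1, (hAB p ⟨by linarith, by linarith⟩).2,
    (hAB (p + L + 2 * δ) ⟨by linarith, by linarith⟩).1,
    (hAB (p + L) ⟨by linarith, by linarith⟩).2]
  exact T

lemma interfaceData_succ {k σ δ L H κ a₁ : ℝ} {N : ℕ} {Ex Ey : ℕ → ℕ → ℝ → ℝ → ℂ} (hk : 0 < k)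
    (hσ : 0 < σ) (hδ : 0 < δ) (hL : 0 < L) (hH : 0 < H) (hκ0 : κ ≠ 0) (hκ : Real.sin (κ * H) = 0)
    (h : IsMaxwellSchwarzError k σ δ L H a₁ N Ex Ey) (n : ℕ) :
    interfaceData k δ L H a₁ κ N Ex Ey (n + 1)
      = (maxwellT k σ δ L κ N).mulVec (interfaceData k δ L H a₁ κ N Ex Ey n) := by
  -- The zero values of `U` at `N - 1` and of `W` at `0` encode the homogeneous outer conditions, so
  -- end subdomains need no separate treatment.
  let U : ℕ → ℂ := fun j => if j < N - 1 then
    cosCoeff H κ (impedanceR k (Ex n (j + 1)) (Ey n (j + 1)) (rightEnd a₁ δ L j)) else 0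
  let W : ℕ → ℂ := fun j => if 0 < j then
    -cosCoeff H κ (impedanceL k (Ex n (j - 1)) (Ey n (j - 1)) (leftEnd a₁ L j)) else 0
  have key := schwarzToeplitz_mulVec (schwarzA (maxwellZeta k σ κ) (Complex.I * k + σ) δ L)
    (schwarzB (maxwellZeta k σ κ) (Complex.I * k + σ) δ L) (N - 1)
    (interfaceData k δ L H a₁ κ N Ex Ey n) U W (by simp [U]) (by simp [W])
    (fun j => by simp [U, interfaceData]) (fun j => by simp [W, interfaceData])
  have hR : ∀ j, j < N → cosCoeff H κ (impedanceR k (Ex (n + 1) j) (Ey (n + 1) j)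
      (rightEnd a₁ δ L j)) = U j := by
    intro j hj
    by_cases hj1 : j < N - 1
    · simp only [U, if_pos hj1]
      exact cosCoeff_congr hH.le fun y hy => h.transmission_right n j (by omega) y hy
    · simp only [U, if_neg hj1]
      rw [← cosCoeff_zero H κ]
      exact cosCoeff_congr hH.le fun y hy => h.boundary_right n j (by omega) y hy
  have hI : ∀ j, j < N → -cosCoeff H κ (impedanceL k (Ex (n + 1) j) (Ey (n + 1) j)
      (leftEnd a₁ L j)) = W j := by
    intro j hj
    rcases j with _ | i
    · simp only [W, lt_irrefl, if_false]
      rw [neg_eq_zero, ← cosCoeff_zero H κ]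
      exact cosCoeff_congr hH.le fun y hy => h.boundary_left hj n y hy
    · simp only [W, Nat.succ_pos, if_true, Nat.add_sub_cancel]
      rw [neg_inj]
      exact cosCoeff_congr hH.le fun y hy => h.transmission_left n i hj y hy
  have step := fun (j : ℕ) (hj : j < N) => maxwell_subdomain (p := leftEnd a₁ L j) hk hσ hδ hL
    hH.le hκ0 hκ (h.smooth_x (n + 1) j hj) (h.smooth_y (n + 1) j hj) (h.maxwell_x n j hj)
    (h.maxwell_y n j hj) (h.pec n j hj)
  have hl : ∀ j : ℕ, leftEnd a₁ L (j + 1) = leftEnd a₁ L j + L := by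
    intro j
    simp only [leftEnd]
    push_cast
    ring
  ext ⟨j, s⟩
  have hj := j.2
  fin_cases s
  · refine Eq.trans ?_ (key j).1.symm
    have hjN : (j : ℕ) + 1 < N := by omega
    rw [← hI _ hjN, ← hR _ hjN]
    change cosCoeff H κ (impedanceR k (Ex (n + 1) (j + 1)) (Ey (n + 1) (j + 1))
      (rightEnd a₁ δ L j)) = _
    rw [rightEnd, ← hl]
    exact (step _ hjN).1
  · refine Eq.trans ?_ (key j).2.symm
    have hjN : (j : ℕ) < N := by omega
    rw [← hI _ hjN, ← hR _ hjN]
    change -cosCoeff H κ (impedanceL k (Ex (n + 1) j) (Ey (n + 1) j) (leftEnd a₁ L (j + 1))) = _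
    rw [hl]
    exact (step _ hjN).2

/-! ### The supremum over the Fourier numbers -/

lemma tendsto_maxwellT {k σ δ L : ℝ} (hk : 0 < k) (hσ : 0 < σ) (hδ : 0 < δ) (hL : 0 < L)
    (κ : ℝ) :
    Tendsto (fun N : ℕ => spectralRadius ℂ (maxwellT k (σ * k) (δ / k) (L / k) κ N)) atTop
      (𝓝 (ENNReal.ofReal (modeFactor σ δ L (κ / k)))) := by
  simp only [maxwellT_eq hk hσ]
  exact (tendsto_spectralRadius_schwarzToeplitz (schwarzB_mode_ne_zero hσ hδ hL _)).comp
    (tendsto_sub_atTop_nat 1)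

lemma maxwellR1d_eq {k σ δ L : ℝ} (hk : 0 < k) (hσ : 0 < σ) (hδ : 0 < δ) (hL : 0 < L) (κ : ℝ) :
    maxwellR1d k (σ * k) (δ / k) (L / k) κ = ENNReal.ofReal (modeFactor σ δ L (κ / k)) :=
  (tendsto_maxwellT hk hσ hδ hL κ).limUnder_eq

lemma ofReal_modeFactor_le {σ δ L : ℝ} (hσ : 0 < σ) (hδ : 0 < δ) (hL : 0 < L) (κ : ℝ) :
    ENNReal.ofReal (modeFactor σ δ L κ) ≤ worstFactor σ δ L := by
  obtain ⟨-, -, h⟩ := exists_worstFactor_eq hσ hδ hL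
  rw [← ENNReal.ofReal_coe_nnreal]
  exact ENNReal.ofReal_le_ofReal (h κ)

lemma maxwellR2d_le {k σ δ L : ℝ} (hk : 0 < k) (hσ : 0 < σ) (hδ : 0 < δ) (hL : 0 < L) (H : ℝ) :
    maxwellR2d H k (σ * k) (δ / k) (L / k) ≤ worstFactor σ δ L :=
  iSup_le fun m => by
    rw [maxwellR1d_eq hk hσ hδ hL]
    exact ofReal_modeFactor_le hσ hδ hL _

lemma maxwellZeta_abs (k σ κ : ℝ) : maxwellZeta k σ |κ| = maxwellZeta k σ κ := by
  have : ((|κ| : ℝ) : ℂ) ^ 2 = (κ : ℂ) ^ 2 := by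
    norm_cast
    rw [sq_abs]
  rw [maxwellZeta, this, maxwellZeta]

/-- Every nonnegative number is a limit of scaled Fourier numbers. -/
lemma tendsto_fourierNumber_div {H κ : ℝ} (hH : 0 < H) (hκ : 0 ≤ κ) :
    Tendsto (fun k : ℝ => fourierNumber H (⌊κ * (H * k / Real.pi)⌋₊ + 1) / k) atTop (𝓝 κ) := by
  have hp := Real.pi_pos
  have h1 : Tendsto (fun k : ℝ => H * k / Real.pi) atTop atTop :=
    (tendsto_id.const_mul_atTop hH).atTop_div_const hp
  have h2 := (tendsto_nat_floor_mul_div_atTop hκ).comp h1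
  -- The added `1` keeps the index positive and shifts the scaled Fourier number by `π / (H k)`,
  -- which vanishes in the limit.
  have h3 := h2.add (tendsto_inv_atTop_zero.comp h1)
  rw [add_zero] at h3
  refine h3.congr' ?_
  filter_upwards [eventually_gt_atTop 0] with k hk
  simp only [Function.comp_apply, fourierNumber]
  push_cast
  field_simp

lemma tendsto_maxwellR2d {σ δ L H : ℝ} (hσ : 0 < σ) (hδ : 0 < δ) (hL : 0 < L) (hH : 0 < H) :
    Tendsto (fun k : ℝ => maxwellR2d H k (σ * k) (δ / k) (L / k)) atTop
      (𝓝 (worstFactor σ δ L : ℝ≥0∞)) := by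
  obtain ⟨κ, hκ, -⟩ := exists_worstFactor_eq hσ hδ hL
  -- The maximiser may be negative while Fourier numbers are positive; the factor is even in `κ`.
  have h0 : modeFactor σ δ L |κ| = worstFactor σ δ L := by
    rw [hκ, modeFactor, maxwellZeta_abs, modeFactor]
  have h1 := ENNReal.tendsto_ofReal (((continuous_modeFactor hσ hδ hL).tendsto |κ|).comp
    (tendsto_fourierNumber_div hH (abs_nonneg κ)))
  rw [h0, ENNReal.ofReal_coe_nnreal] at h1
  refine tendsto_of_tendsto_of_tendsto_of_le_of_le' h1 tendsto_const_nhds ?_ ?_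
  · filter_upwards [eventually_gt_atTop 0] with k hk
    rw [Function.comp_apply, ← maxwellR1d_eq hk hσ hδ hL]
    exact le_iSup (fun m : {m : ℕ // 1 ≤ m} =>
      maxwellR1d k (σ * k) (δ / k) (L / k) (fourierNumber H m)) ⟨_, Nat.le_add_left 1 _⟩
  · filter_upwards [eventually_gt_atTop 0] with k hk using maxwellR2d_le hk hσ hδ hL H

/-! ### Assembly of the theorem -/

theorem corollary4p5 :
    ∃ Rbar : ℝ → ℝ → ℝ → ℝ≥0,
      (∀ σ₀ δ₀ L₀ : ℝ, 0 < σ₀ → 0 < δ₀ → 0 < L₀ → ∀ Lhat : ℝ, 0 < Lhat →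
        -- the limits that define the convergence factors exist, for every mode
        (∀ k : ℝ, 0 < k → ∀ m : ℕ, 1 ≤ m →
          Tendsto
            (fun N : ℕ => spectralRadius ℂ
              (maxwellT k (σ₀ * k) (δ₀ / k) (L₀ / k) (fourierNumber Lhat m) N))
            atTop
            (𝓝 (maxwellR1d k (σ₀ * k) (δ₀ / k) (L₀ / k) (fourierNumber Lhat m)))) ∧
        -- the bound, independent of the wave number
        (∀ k : ℝ, 0 < k →
          maxwellR2d Lhat k (σ₀ * k) (δ₀ / k) (L₀ / k) ≤ (Rbar σ₀ δ₀ L₀ : ℝ≥0∞)) ∧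
        -- the bound becomes tight
        Tendsto (fun k : ℝ => maxwellR2d Lhat k (σ₀ * k) (δ₀ / k) (L₀ / k)) atTop
          (𝓝 (Rbar σ₀ δ₀ L₀ : ℝ≥0∞)) ∧
        -- for any number of subdomains, the matrix is the iteration matrix of the Schwarz method,
        -- and the method converges with a rate independent of wave number and subdomains
        (∀ k : ℝ, 0 < k → ∀ m : ℕ, 1 ≤ m → ∀ N : ℕ,
          spectralRadius ℂ (maxwellT k (σ₀ * k) (δ₀ / k) (L₀ / k) (fourierNumber Lhat m) N)
            ≤ (Rbar σ₀ δ₀ L₀ : ℝ≥0∞) ∧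
          ∀ (a₁ : ℝ) (Ex Ey : ℕ → ℕ → ℝ → ℝ → ℂ),
            IsMaxwellSchwarzError k (σ₀ * k) (δ₀ / k) (L₀ / k) Lhat a₁ N Ex Ey →
            ∀ n : ℕ,
              interfaceData k (δ₀ / k) (L₀ / k) Lhat a₁ (fourierNumber Lhat m) N Ex Ey (n + 1)
                = (maxwellT k (σ₀ * k) (δ₀ / k) (L₀ / k) (fourierNumber Lhat m) N).mulVec
                    (interfaceData k (δ₀ / k) (L₀ / k) Lhat a₁ (fourierNumber Lhat m) N Ex Ey n) ∧
              ‖WithLp.toLp 2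
                  (interfaceData k (δ₀ / k) (L₀ / k) Lhat a₁ (fourierNumber Lhat m) N Ex Ey n)‖
                ≤ (Rbar σ₀ δ₀ L₀ : ℝ) ^ n *
                  ‖WithLp.toLp 2
                    (interfaceData k (δ₀ / k) (L₀ / k) Lhat a₁ (fourierNumber Lhat m) N Ex Ey
                      0)‖)) ∧
      -- sufficient conditions for convergence
      (∀ σ₀ δ₀ L₀ : ℝ, 1 ≤ σ₀ → 0 < δ₀ → 0 < L₀ → Rbar σ₀ δ₀ L₀ < 1) ∧
      (∀ σ₀ : ℝ, 0 < σ₀ → ∃ M : ℝ, ∀ δ₀ L₀ : ℝ, 0 < δ₀ → 0 < L₀ → M ≤ max δ₀ L₀ →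
        Rbar σ₀ δ₀ L₀ < 1) := by

  refine ⟨worstFactor, fun σ δ L hσ hδ hL H hH => ⟨fun k hk m _ => ?_,
    fun k hk => maxwellR2d_le hk hσ hδ hL H, tendsto_maxwellR2d hσ hδ hL hH,
    fun k hk m hm N => ⟨?_, fun a₁ Ex Ey hE n => ?_⟩⟩,
    fun σ δ L hσ hδ hL => ?_, fun σ hσ => ?_⟩
  · rw [maxwellR1d_eq hk hσ hδ hL]
    exact tendsto_maxwellT hk hσ hδ hL _
  · rw [maxwellT_eq hk hσ]
    exact (spectralRadius_schwarzToeplitz_le _ _ _).trans (ofReal_modeFactor_le hσ hδ hL _)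
  · have step := interfaceData_succ hk (mul_pos hσ hk) (div_pos hδ hk) (div_pos hL hk) hH
      (fourierNumber_ne_zero hH hm) (sin_fourierNumber_mul hH m) hE
    refine ⟨step n, ?_⟩
    obtain ⟨-, -, hle⟩ := exists_worstFactor_eq hσ hδ hL
    induction n with
    | zero => simp
    | succ n ih =>
      rw [step n, maxwellT_eq hk hσ, pow_succ']
      refine (norm_schwarzToeplitz_mulVec_le _ _ _ _).trans ?_
      rw [mul_assoc]
      exact mul_le_mul (hle _) ih (norm_nonneg _) (NNReal.coe_nonneg _)
  · have hσ' : 0 < σ := one_pos.trans_le hσ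
    exact worstFactor_lt_one hσ' hδ hL fun κ => modeFactor_lt_one_of_le hσ' hδ hL (Or.inr hσ)
  · obtain ⟨M, hM⟩ := exists_forall_modeFactor_lt_one hσ
    exact ⟨M, fun δ L hδ hL h => worstFactor_lt_one hσ hδ hL (hM δ L hδ hL h)⟩
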